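/- Let $d$ be a natural number. A Lévy measure on $\mathbb R^d$ is a Borel measure $M$ with $M(\{0\})=0$ and $\int_{\mathbb R^d}(|x|^2\wedge 1)\,M(\mathrm dx)<\infty$. For a Borel measure $\rho$ on $(0,\infty)$ and a Lévy measure $M$ put $$[\Upsilon_\rho M](B)=\int_0^\infty M(s^{-1}B)\,\rho(\mathrm ds)\qquad (B\subset\mathbb R^d \text{ Borel}).$$ Let $\mathfrak D(\Upsilon_\rho)$ be the set of all Lévy measures $M$ for which $\Upsilon_\rho M$ is a Lévy measure, and let $\mathfrak R(\Upsilon_\rho)$ be the set of all Lévy measures of the form $\Upsilon_\rho M'$ with $M'\in\mathfrak D(\Upsilon_\rho)$. For $\alpha\in\mathbb R$ and $p>0$ let $\Psi_{\alpha,p}=\Upsilon_\rho$ with $$\rho(\mathrm ds)=s^{-\alpha-1}e^{-s^p}1_{s>0}\,\mathrm ds.$$ For $\beta<\alpha$ and $p>0$ let $\mathfrak T_{\beta\to\alpha,p}=\Upsilon_\rho$ with $$\rho(\mathrm ds)=K_{\alpha,\beta,p}^{-1}\,s^{-\alpha-1}(1-s^p)^{(\alpha-\beta)/p-1}1_{0<s<1}\,\mathrm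 ds,\qquad K_{\alpha,\beta,p}=\int_0^\infty u^{\alpha-\beta-1}e^{-u^p}\,\mathrm du.$$ For $\alpha\in\mathbb R$ and $0<q<p$ let $\mathfrak P_{\alpha,p\to q}=\Upsilon_\rho$ with $$\rho(\mathrm ds)=p\,f_{q/p}(s^{-p})\,s^{-\alpha-p-1}1_{s>0}\,\mathrm ds,$$ where for $r\in(0,1)$ the function $f_r$ is the probability density on $(0,\infty)$ with $\int_0^\infty e^{-tx}f_r(x)\,\mathrm dx=e^{-t^r}$ for all $t\ge 0$ (the fully right-skewed $r$-stable density). If $-\infty<\gamma<\beta<\alpha<\infty$ and $0<r<q<p<\infty$, then $$\mathfrak R(\mathfrak T_{\beta\to\alpha,p})\subset\mathfrak D(\Psi_{\beta,p}),\qquad \mathfrak R(\mathfrak T_{\beta\to\alpha,p})\subset\mathfrak D(\mathfrak T_{\gamma\to\beta,p}),$$ $$\mathfrak R(\Psi_{\alpha,p})\subset\mathfrak D(\mathfrak P_{\alpha,p\to q}),\qquad \mathfrak R(\mathfrak P_{\alpha,q\to r})\subset\mathfrak D(\mathfrak P_{\alpha,p\to q}),\qquad \mathfrak R(\mathfrak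 T_{\beta\to\alpha,p})\subset\mathfrak D(\mathfrak P_{\alpha,p\to q}).$$ -/

import Mathlib

namespace UpsilonTransform

section

open MeasureTheory Set Filter Topology
open scoped ENNReal Pointwise

/-! ### Existence of the one-sided stable densities

The facts of this section serve only to show that the density `stableDensity r` exists. -/

/-- `L` is the Laplace transform, on `(0, ∞)`, of a probability measure on `[0, ∞]`, written in
the variable `w = exp (-x) ∈ [0, 1]`. -/
def IsLaplace (L : ℝ → ℝ) : Prop :=
  ∃ μ : ProbabilityMeasure unitInterval, ∀ t, 0 < t → ∫ w, (w : ℝ) ^ t ∂(μ : Measure unitInterval) = L t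

theorem IsLaplace.mul {L₁ L₂ : ℝ → ℝ} (h₁ : IsLaplace L₁) (h₂ : IsLaplace L₂) : IsLaplace (fun t => L₁ t * L₂ t) := by
  obtain ⟨μ, hμ⟩ := h₁
  obtain ⟨ν, hν⟩ := h₂
  have hm : Measurable (fun z : unitInterval × unitInterval => z.1 * z.2) :=
    (continuous_fst.mul continuous_snd).measurable
  refine ⟨⟨((μ : Measure unitInterval).prod ν).map (fun z => z.1 * z.2),
    Measure.isProbabilityMeasure_map hm.aemeasurable⟩, fun t ht => ?_⟩
  show ∫ w : unitInterval, (w : ℝ) ^ t ∂(((μ : Measure unitInterval).prod (ν : Measure unitInterval)).map fun z => z.1 * z.2) = L₁ t * L₂ t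
  rw [← hμ t ht, ← hν t ht, ← integral_prod_mul]
  rw [integral_map hm.aemeasurable]
  · refine integral_congr_ae (Eventually.of_forall fun z => ?_)
    exact Real.mul_rpow z.1.2.1 z.2.2.1
  · exact ((continuous_subtype_val.rpow_const (fun _ => Or.inr ht.le))).aestronglyMeasurable

theorem IsLaplace.one : IsLaplace (fun _ => 1) :=
  ⟨⟨Measure.dirac 1, inferInstance⟩, fun t _ => by simp⟩

theorem IsLaplace.pow {L : ℝ → ℝ} (h : IsLaplace L) (n : ℕ) : IsLaplace (fun t => L t ^ n) := by
  induction n with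
  | zero => simpa using IsLaplace.one
  | succ n ih => simpa only [pow_succ] using ih.mul h

theorem IsLaplace.dilate {L : ℝ → ℝ} (h : IsLaplace L) {c : ℝ} (hc : 0 < c) : IsLaplace (fun t => L (c * t)) := by
  obtain ⟨μ, hμ⟩ := h
  let φ : unitInterval → unitInterval := fun w =>
    ⟨(w : ℝ) ^ c, Real.rpow_nonneg w.2.1 _, Real.rpow_le_one w.2.1 w.2.2 hc.le⟩
  have hφ : Continuous φ :=
    (continuous_subtype_val.rpow_const (fun _ => Or.inr hc.le)).subtype_mk _
  refine ⟨⟨(μ : Measure unitInterval).map φ,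
    Measure.isProbabilityMeasure_map hφ.measurable.aemeasurable⟩, fun t ht => ?_⟩
  show ∫ w, (w : ℝ) ^ t ∂((μ : Measure unitInterval).map φ) = L (c * t)
  rw [← hμ _ (mul_pos hc ht)]
  rw [integral_map hφ.measurable.aemeasurable]
  · refine integral_congr_ae (Eventually.of_forall fun z => ?_)
    exact (Real.rpow_mul z.2.1 _ _).symm
  · exact ((continuous_subtype_val.rpow_const (fun _ => Or.inr ht.le))).aestronglyMeasurable

theorem IsLaplace.lim {L : ℕ → ℝ → ℝ} {L' : ℝ → ℝ} (h : ∀ n, IsLaplace (L n))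
    (hl : ∀ t, 0 < t → Tendsto (fun n => L n t) atTop (𝓝 (L' t))) : IsLaplace L' := by
  choose μ hμ using h
  obtain ⟨ν, -, hν⟩ := isCompact_univ.exists_mapClusterPt (f := (atTop : Filter ℕ)) (u := μ) (by simp)
  obtain ⟨U, hU, hU'⟩ := mapClusterPt_iff_ultrafilter.1 hν
  refine ⟨ν, fun t ht => ?_⟩
  have h1 := ProbabilityMeasure.tendsto_iff_forall_integral_tendsto.1 hU'
    (BoundedContinuousFunction.mkOfCompact
      ⟨fun w : unitInterval => (w : ℝ) ^ t, continuous_subtype_val.rpow_const (fun _ => Or.inr ht.le)⟩)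
  have h2 := (hl t ht).mono_left hU
  refine tendsto_nhds_unique h1 (h2.congr fun n => ?_)
  exact (hμ n t ht).symm

theorem lintegral_gamma {r : ℝ} (h1 : r < 1) {u : ℝ} (hu : 0 < u) :
    ∫⁻ x in Ioi (0 : ℝ), ENNReal.ofReal (x ^ (-r) * Real.exp (-(u * x)))
      = ENNReal.ofReal (Real.Gamma (1 - r) * u ^ (r - 1)) := by
  have h := Real.integral_rpow_mul_exp_neg_mul_Ioi (a := 1 - r) (r := u) (by linarith) hu
  have e : (1 / u) ^ (1 - r) * Real.Gamma (1 - r) = Real.Gamma (1 - r) * u ^ (r - 1) := by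
    rw [one_div, Real.inv_rpow hu.le, ← Real.rpow_neg hu.le, mul_comm]; ring_nf
  have e2 : (1 - r - 1 : ℝ) = -r := by ring
  rw [e, e2] at h
  rw [← h, ofReal_integral_eq_lintegral_ofReal]
  · refine not_imp_comm.1 integral_undef ?_
    rw [h]
    have := Real.Gamma_pos_of_pos (by linarith : 0 < 1 - r)
    positivity
  · refine (ae_restrict_mem measurableSet_Ioi).mono fun x hx => ?_
    have : (0 : ℝ) < x := hx
    simp only [Pi.zero_apply]; positivity

theorem lintegral_exp_tail {t x : ℝ} (hx : 0 < x) :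
    ENNReal.ofReal (Real.exp (-(t * x))) =
      ENNReal.ofReal x * ∫⁻ u in Ioi t, ENNReal.ofReal (Real.exp (-(u * x))) := by
  have h := integral_exp_mul_Ioi (a := -x) (by linarith) t
  have hi := integrableOn_exp_mul_Ioi (a := -x) (by linarith) t
  rw [show (∫⁻ u in Ioi t, ENNReal.ofReal (Real.exp (-(u * x))))
    = ENNReal.ofReal (∫ u in Ioi t, Real.exp (-x * u)) by
      rw [ofReal_integral_eq_lintegral_ofReal hi (Eventually.of_forall fun _ => (Real.exp_pos _).le)]
      simp only [neg_mul, mul_comm x], h, ← ENNReal.ofReal_mul hx.le]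
  congr 1
  field_simp

theorem lintegral_exp_rpow_tail {r : ℝ} (h0 : 0 < r) {t : ℝ} (ht : 0 ≤ t) :
    ∫⁻ u in Ioi t, ENNReal.ofReal (r * u ^ (r - 1) * Real.exp (-u ^ r))
      = ENNReal.ofReal (Real.exp (-t ^ r)) := by
  have hc : ContinuousWithinAt (fun u : ℝ => -Real.exp (-u ^ r)) (Ici t) t :=
    (Real.continuous_exp.comp (Real.continuous_rpow_const h0.le).neg).neg.continuousWithinAt
  have hd : ∀ u ∈ Ioi t, HasDerivAt (fun u : ℝ => -Real.exp (-u ^ r))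
      (r * u ^ (r - 1) * Real.exp (-u ^ r)) u := by
    intro u hu
    have : u ≠ 0 := (ht.trans_lt hu).ne'
    have := ((Real.hasDerivAt_rpow_const (p := r) (Or.inl this)).neg.exp).neg
    refine this.congr_deriv ?_
    simp only [Pi.neg_apply]
    ring
  have hp : ∀ u ∈ Ioi t, 0 ≤ r * u ^ (r - 1) * Real.exp (-u ^ r) := by
    intro u hu
    have : 0 < u := ht.trans_lt hu
    positivity
  have hl : Tendsto (fun u : ℝ => -Real.exp (-u ^ r)) atTop (𝓝 0) := by
    have := (Real.tendsto_exp_neg_atTop_nhds_zero.comp (tendsto_rpow_atTop h0)).neg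
    simpa using this
  have hi := integrableOn_Ioi_deriv_of_nonneg hc hd hp hl
  rw [← ofReal_integral_eq_lintegral_ofReal hi
    ((ae_restrict_mem measurableSet_Ioi).mono fun u hu => hp u hu),
    integral_Ioi_of_hasDerivAt_of_tendsto hc hd hi hl]
  simp

theorem lintegral_rpow_shift {r : ℝ} (h0 : 0 < r) {t : ℝ} (ht : 0 ≤ t) :
    ∫⁻ u in Ioc (0 : ℝ) 1, ENNReal.ofReal (r * (u + t) ^ (r - 1))
      = ENNReal.ofReal ((1 + t) ^ r - t ^ r) := by
  have hi : IntervalIntegrable (fun u : ℝ => r * (u + t) ^ (r - 1)) volume 0 1 := by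
    have h := (intervalIntegral.intervalIntegrable_rpow' (a := t) (b := 1 + t) (r := r - 1)
      (by linarith)).comp_add_right t
    simpa using h.const_mul r
  rw [← ofReal_integral_eq_lintegral_ofReal]
  · rw [← intervalIntegral.integral_of_le zero_le_one, intervalIntegral.integral_const_mul,
      intervalIntegral.integral_comp_add_right (fun x : ℝ => x ^ (r - 1)),
      integral_rpow (Or.inl (by linarith))]
    congr 1
    rw [zero_add, sub_add_cancel]
    field_simp
  · exact (intervalIntegrable_iff_integrableOn_Ioc_of_le zero_le_one).1 hi
  · refine (ae_restrict_mem measurableSet_Ioc).mono fun u hu => ?_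
    have : 0 < u := hu.1
    simp only [Pi.zero_apply]; positivity

theorem isLaplace_base {r : ℝ} (h0 : 0 < r) (h1 : r < 1) :
    IsLaplace (fun t => (1 + t) ^ r - t ^ r) := by
  have hΓ : 0 < Real.Gamma (1 - r) := Real.Gamma_pos_of_pos (by linarith)
  let k : ℝ := r / Real.Gamma (1 - r)
  have hk : 0 < k := by positivity
  let D : ℝ → ℝ≥0∞ := fun x =>
    ∫⁻ u in Ioc (0 : ℝ) 1, ENNReal.ofReal (k * (x ^ (-r) * Real.exp (-(u * x))))
  have hJ : Measurable (fun z : ℝ × ℝ =>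
      ENNReal.ofReal (k * (z.1 ^ (-r) * Real.exp (-(z.2 * z.1))))) := by fun_prop
  have hD : Measurable D := hJ.lintegral_prod_right'
  let κ : Measure ℝ := (volume.restrict (Ioi 0)).withDensity D
  have key : ∀ t : ℝ, 0 ≤ t → ∫⁻ x, ENNReal.ofReal (Real.exp (-(t * x))) ∂κ
      = ENNReal.ofReal ((1 + t) ^ r - t ^ r) := by
    intro t ht
    rw [lintegral_withDensity_eq_lintegral_mul _ hD (by fun_prop)]
    calc ∫⁻ x in Ioi (0 : ℝ), (D * fun x => ENNReal.ofReal (Real.exp (-(t * x)))) x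
        = ∫⁻ x in Ioi (0 : ℝ), ∫⁻ u in Ioc (0 : ℝ) 1,
            ENNReal.ofReal (k * (x ^ (-r) * Real.exp (-((u + t) * x)))) := by
          refine setLIntegral_congr_fun measurableSet_Ioi fun x hx => ?_
          have hx' : (0 : ℝ) < x := hx
          simp only [Pi.mul_apply, D]
          rw [← lintegral_mul_const _ (by fun_prop)]
          refine lintegral_congr fun u => ?_
          rw [← ENNReal.ofReal_mul (by positivity)]
          congr 1
          rw [mul_assoc, mul_assoc, ← Real.exp_add]
          ring_nf
      _ = ∫⁻ u in Ioc (0 : ℝ) 1, ∫⁻ x in Ioi (0 : ℝ),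
            ENNReal.ofReal (k * (x ^ (-r) * Real.exp (-((u + t) * x)))) := by
          exact lintegral_lintegral_swap (by fun_prop)
      _ = ∫⁻ u in Ioc (0 : ℝ) 1, ENNReal.ofReal (r * (u + t) ^ (r - 1)) := by
          refine setLIntegral_congr_fun measurableSet_Ioc fun u hu => ?_
          have hu' : 0 < u + t := by linarith [hu.1]
          simp only [ENNReal.ofReal_mul hk.le]
          rw [lintegral_const_mul _ (by fun_prop), lintegral_gamma h1 hu',
            ← ENNReal.ofReal_mul hk.le]
          congr 1
          simp only [k]
          field_simp
      _ = _ := lintegral_rpow_shift h0 ht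
  have hκ : IsProbabilityMeasure κ := ⟨by
    have := key 0 le_rfl
    simpa [Real.zero_rpow h0.ne'] using this⟩
  let φ : ℝ → unitInterval := fun x => projIcc 0 1 zero_le_one (Real.exp (-x))
  have hφ : Measurable φ := (continuous_projIcc.comp (by fun_prop)).measurable
  refine ⟨⟨κ.map φ, Measure.isProbabilityMeasure_map hφ.aemeasurable⟩, fun t ht => ?_⟩
  show ∫ w, (w : ℝ) ^ t ∂(κ.map φ) = (1 + t) ^ r - t ^ r
  rw [integral_map hφ.aemeasurable
    ((continuous_subtype_val.rpow_const (fun _ => Or.inr ht.le))).aestronglyMeasurable]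
  have hpos : ∀ᵐ x ∂κ, 0 < x :=
    (withDensity_absolutelyContinuous _ _).ae_le (ae_restrict_mem measurableSet_Ioi)
  rw [integral_congr_ae (g := fun x => Real.exp (-(t * x)))]
  · rw [integral_eq_lintegral_of_nonneg_ae (Eventually.of_forall fun _ => (Real.exp_pos _).le)
      (by fun_prop), key t ht.le, ENNReal.toReal_ofReal]
    exact sub_nonneg.2 (Real.rpow_le_rpow ht.le (by linarith) h0.le)
  · filter_upwards [hpos] with x hx
    have : Real.exp (-x) ∈ Icc (0 : ℝ) 1 := ⟨(Real.exp_pos _).le, by simpa using hx.le⟩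
    simp only [φ, projIcc_of_mem zero_le_one this]
    rw [← Real.exp_mul]
    ring_nf

theorem isLaplace_stable {r : ℝ} (h0 : 0 < r) (h1 : r < 1) :
    IsLaplace (fun t => Real.exp (-t ^ r)) := by
  let s : ℕ → ℝ := fun n => ((n : ℝ) + 1) ^ (-(1 / r))
  have hs : ∀ n, 0 < s n := fun n => Real.rpow_pos_of_pos (by positivity) _
  refine IsLaplace.lim (L := fun n t => ((1 + s n * t) ^ r - (s n * t) ^ r) ^ (n + 1))
    (fun n => ((isLaplace_base h0 h1).dilate (hs n)).pow (n + 1)) fun t ht => ?_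
  have hsr : ∀ n : ℕ, ((n : ℝ) + 1) * (s n * t) ^ r = t ^ r := by
    intro n
    have hn : (0 : ℝ) < (n : ℝ) + 1 := by positivity
    rw [Real.mul_rpow (hs n).le ht.le, ← Real.rpow_mul hn.le]
    rw [show -(1 / r) * r = -1 by field_simp, Real.rpow_neg_one]
    field_simp
  have hlim : Tendsto (fun n : ℕ => ((n : ℝ) + 1) * ((1 + s n * t) ^ r - (s n * t) ^ r - 1))
      atTop (𝓝 (-t ^ r)) := by
    have hz : Tendsto (fun n : ℕ => ((n : ℝ) + 1) * (r * (s n * t))) atTop (𝓝 0) := by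
      have e : ∀ n : ℕ, ((n : ℝ) + 1) * (r * (s n * t)) = r * t * ((n : ℝ) + 1) ^ (-(1 / r - 1)) := by
        intro n
        have hn : (0 : ℝ) < (n : ℝ) + 1 := by positivity
        rw [show -(1 / r - 1) = -(1 / r) + 1 by ring, Real.rpow_add_one hn.ne']
        ring
      simp only [e]
      have hr : 0 < 1 / r - 1 := by
        rw [sub_pos]; exact (one_lt_div h0).2 h1
      have := ((tendsto_rpow_neg_atTop hr).comp
        (tendsto_natCast_atTop_atTop.atTop_add (tendsto_const_nhds (x := (1 : ℝ))))).const_mul (r * t)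
      simpa using this
    have hz' : Tendsto (fun n : ℕ => ((n : ℝ) + 1) * ((1 + s n * t) ^ r - 1)) atTop (𝓝 0) := by
      refine squeeze_zero (fun n => ?_) (fun n => ?_) hz
      · have : 0 < s n * t := mul_pos (hs n) ht
        have := Real.one_le_rpow (by linarith : 1 ≤ 1 + s n * t) h0.le
        have : 0 ≤ (1 + s n * t) ^ r - 1 := by linarith
        positivity
      · have : 0 < s n * t := mul_pos (hs n) ht
        have := rpow_one_add_le_one_add_mul_self (by linarith : -1 ≤ s n * t) h0.le h1.le
        exact mul_le_mul_of_nonneg_left (by linarith) (by positivity)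
    have := hz'.sub_const (t ^ r)
    rw [zero_sub] at this
    refine this.congr fun n => ?_
    rw [← hsr n]; ring
  have hlim2 : Tendsto (fun n : ℕ => (n : ℝ) *
      ((1 + s (n - 1) * t) ^ r - (s (n - 1) * t) ^ r - 1)) atTop (𝓝 (-t ^ r)) := by
    rw [← tendsto_add_atTop_iff_nat 1]
    simpa using hlim
  have := Real.tendsto_one_add_pow_exp_of_tendsto hlim2
  rw [← tendsto_add_atTop_iff_nat 1] at this
  simpa using this

/-- `f` is a density on `(0, ∞)` (extended by `0` to the real line) of the fully right-skewed
`r`-stable distribution, the one with Laplace transform `t ↦ exp (-t ^ r)`. -/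
structure IsStableDensity (r : ℝ) (f : ℝ → ℝ) : Prop where
  measurable : Measurable f
  nonneg : ∀ x, 0 ≤ f x
  eq_zero : ∀ x ≤ 0, f x = 0
  laplace : ∀ t, 0 ≤ t → ∫ x in Ioi (0 : ℝ), Real.exp (-(t * x)) * f x = Real.exp (-t ^ r)

theorem exists_isStableDensity {r : ℝ} (h0 : 0 < r) (h1 : r < 1) : ∃ f, IsStableDensity r f := by
  obtain ⟨μ, hμ⟩ := isLaplace_stable h0 h1
  have hΓ : 0 < Real.Gamma (1 - r) := Real.Gamma_pos_of_pos (by linarith)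
  let k : ℝ := r / Real.Gamma (1 - r)
  have hk : 0 < k := by positivity
  -- `y = -log w` is the size variable carried by `μ`; the atom at `w = 0` is discarded
  let H : ℝ → unitInterval → ℝ≥0∞ := fun x w => if 0 < (w : ℝ) ∧ 0 < x + Real.log w then
    ENNReal.ofReal (k * (x + Real.log w) ^ (-r)) else 0
  have hset : MeasurableSet {z : ℝ × unitInterval | 0 < (z.2 : ℝ) ∧ 0 < z.1 + Real.log z.2} :=
    (measurableSet_lt (f := fun _ : ℝ × unitInterval => (0 : ℝ)) (g := fun z => (z.2 : ℝ))
      (by fun_prop) (by fun_prop)).inter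
      (measurableSet_lt (f := fun _ : ℝ × unitInterval => (0 : ℝ))
        (g := fun z => z.1 + Real.log z.2) (by fun_prop) (by fun_prop))
  have hH : Measurable (fun z : ℝ × unitInterval => H z.1 z.2) :=
    Measurable.ite hset (by fun_prop) measurable_const
  let G : ℝ → ℝ≥0∞ := fun x => ∫⁻ w, H x w ∂(μ : Measure unitInterval)
  have hG : Measurable G := hH.lintegral_prod_right'
  have inner : ∀ u : ℝ, 0 < u → ∫⁻ x in Ioi (0 : ℝ), ENNReal.ofReal (Real.exp (-(u * x))) * G x
      = ENNReal.ofReal (r * u ^ (r - 1) * Real.exp (-u ^ r)) := by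
    intro u hu
    have hswap : ∫⁻ x in Ioi (0 : ℝ), ENNReal.ofReal (Real.exp (-(u * x))) * G x
        = ∫⁻ w, (∫⁻ x in Ioi (0 : ℝ), ENNReal.ofReal (Real.exp (-(u * x))) * H x w)
            ∂(μ : Measure unitInterval) := by
      rw [← lintegral_lintegral_swap]
      · refine lintegral_congr fun x => ?_
        exact (lintegral_const_mul _ (hH.comp measurable_prodMk_left)).symm
      · exact ((by fun_prop : Measurable fun z : ℝ × unitInterval =>
          ENNReal.ofReal (Real.exp (-(u * z.1)))).mul hH).aemeasurable
    have hw : ∀ w : unitInterval,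
        ∫⁻ x in Ioi (0 : ℝ), ENNReal.ofReal (Real.exp (-(u * x))) * H x w
          = ENNReal.ofReal (r * u ^ (r - 1)) * ENNReal.ofReal ((w : ℝ) ^ u) := by
      intro w
      rcases w.2.1.eq_or_lt with hw0 | hw0
      · have hn : ¬ (0 : ℝ) < w := by rw [← hw0]; exact lt_irrefl _
        simp only [H, hn, false_and, if_false, mul_zero, lintegral_zero]
        rw [← hw0, Real.zero_rpow hu.ne', ENNReal.ofReal_zero, mul_zero]
      have hl : Real.log w ≤ 0 := Real.log_nonpos w.2.1 w.2.2
      have e1 : ∫⁻ x in Ioi (0 : ℝ), ENNReal.ofReal (Real.exp (-(u * x))) * H x w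
          = ∫⁻ x, (Ioi (0 : ℝ)).indicator (fun y => ENNReal.ofReal (k * (w : ℝ) ^ u) *
              ENNReal.ofReal (y ^ (-r) * Real.exp (-(u * y)))) (x + Real.log w) := by
        rw [← lintegral_indicator measurableSet_Ioi]
        refine lintegral_congr fun x => ?_
        by_cases hx : 0 < x + Real.log w
        · have hx0 : 0 < x := by linarith
          simp only [indicator, mem_Ioi, hx0, hx, H, hw0, and_self, if_true]
          rw [← ENNReal.ofReal_mul (by positivity), ← ENNReal.ofReal_mul (by positivity)]
          congr 1
          rw [Real.rpow_def_of_pos hw0]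
          have : Real.exp (-(u * x)) = Real.exp (Real.log w * u) *
              Real.exp (-(u * (x + Real.log w))) := by
            rw [← Real.exp_add]; ring_nf
          rw [this]; ring
        · simp [indicator, hx, H]
      rw [e1, lintegral_add_right_eq_self (μ := volume)
        ((Ioi (0 : ℝ)).indicator (fun y => ENNReal.ofReal (k * (w : ℝ) ^ u) *
              ENNReal.ofReal (y ^ (-r) * Real.exp (-(u * y))))) (Real.log w),
        lintegral_indicator measurableSet_Ioi, lintegral_const_mul _ (by fun_prop),
        lintegral_gamma h1 hu, ← ENNReal.ofReal_mul (by positivity),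
        ← ENNReal.ofReal_mul (by positivity)]
      congr 1
      simp only [k]
      field_simp
    rw [hswap]
    simp only [hw]
    have hc : Continuous fun w : unitInterval => (w : ℝ) ^ u :=
      continuous_subtype_val.rpow_const (fun _ => Or.inr hu.le)
    have hci : Integrable (fun w : unitInterval => (w : ℝ) ^ u) (μ : Measure unitInterval) :=
      (BoundedContinuousFunction.mkOfCompact ⟨_, hc⟩).integrable _
    rw [lintegral_const_mul _ hc.measurable.ennreal_ofReal,
      ← ofReal_integral_eq_lintegral_ofReal hci
        (Eventually.of_forall fun w => Real.rpow_nonneg w.2.1 _), hμ u hu,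
      ← ENNReal.ofReal_mul (by positivity)]
  let F : ℝ → ℝ≥0∞ := fun x => (ENNReal.ofReal x)⁻¹ * G x
  have hF : Measurable F := (ENNReal.measurable_ofReal.inv).mul hG
  have key : ∀ t : ℝ, 0 ≤ t → ∫⁻ x in Ioi (0 : ℝ), ENNReal.ofReal (Real.exp (-(t * x))) * F x
      = ENNReal.ofReal (Real.exp (-t ^ r)) := by
    intro t ht
    rw [← lintegral_exp_rpow_tail h0 ht]
    calc ∫⁻ x in Ioi (0 : ℝ), ENNReal.ofReal (Real.exp (-(t * x))) * F x
        = ∫⁻ x in Ioi (0 : ℝ), ∫⁻ u in Ioi t, ENNReal.ofReal (Real.exp (-(u * x))) * G x := by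
          refine setLIntegral_congr_fun measurableSet_Ioi fun x hx => ?_
          have hx' : (0 : ℝ) < x := hx
          rw [lintegral_mul_const _ (by fun_prop), lintegral_exp_tail hx']
          simp only [F]
          rw [mul_comm (ENNReal.ofReal x), mul_assoc, ← mul_assoc (ENNReal.ofReal x),
            ENNReal.mul_inv_cancel (by simpa using hx') ENNReal.ofReal_ne_top, one_mul]
      _ = ∫⁻ u in Ioi t, ∫⁻ x in Ioi (0 : ℝ), ENNReal.ofReal (Real.exp (-(u * x))) * G x := by
          refine lintegral_lintegral_swap (Measurable.aemeasurable ?_)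
          exact (by fun_prop : Measurable fun z : ℝ × ℝ =>
            ENNReal.ofReal (Real.exp (-(z.2 * z.1)))).mul (hG.comp measurable_fst)
      _ = _ := setLIntegral_congr_fun measurableSet_Ioi fun u hu => inner u (ht.trans_lt hu)
  have hfin : ∀ᵐ x ∂(volume.restrict (Ioi (0 : ℝ))), F x < ∞ := by
    refine ae_lt_top hF ?_
    have := key 0 le_rfl
    simp only [zero_mul, neg_zero, Real.exp_zero, ENNReal.ofReal_one, one_mul] at this
    rw [this]; exact ENNReal.ofReal_ne_top
  refine ⟨(Ioi (0 : ℝ)).indicator fun x => (F x).toReal, ?_, ?_, ?_, ?_⟩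
  · exact hF.ennreal_toReal.indicator measurableSet_Ioi
  · exact fun x => indicator_nonneg (fun _ _ => ENNReal.toReal_nonneg) x
  · exact fun x hx => indicator_of_notMem (by simpa using hx) _
  · intro t ht
    rw [integral_eq_lintegral_of_nonneg_ae]
    · rw [← ENNReal.toReal_ofReal (Real.exp_pos (-t ^ r)).le, ← key t ht]
      congr 1
      refine lintegral_congr_ae ?_
      filter_upwards [hfin, ae_restrict_mem measurableSet_Ioi] with x hx hx0
      rw [indicator_of_mem hx0, ENNReal.ofReal_mul (Real.exp_pos _).le,
        ENNReal.ofReal_toReal hx.ne]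
    · exact Eventually.of_forall fun x => mul_nonneg (Real.exp_pos _).le
        (indicator_nonneg (fun _ _ => ENNReal.toReal_nonneg) x)
    · exact ((by fun_prop : Measurable fun x : ℝ => Real.exp (-(t * x))).mul
        (hF.ennreal_toReal.indicator measurableSet_Ioi)).aestronglyMeasurable

/-- The density `f_r` of the fully right-skewed `r`-stable distribution with Laplace transform
`exp (-t ^ r)`, for `r ∈ (0, 1)`. The Laplace transform determines it up to Lebesgue-null sets. -/
noncomputable def stableDensity (r : ℝ) : ℝ → ℝ :=
  open Classical in
  if h : 0 < r ∧ r < 1 then (exists_isStableDensity h.1 h.2).choose else 0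

theorem stableDensity_spec {r : ℝ} (h0 : 0 < r) (h1 : r < 1) :
    IsStableDensity r (stableDensity r) := by
  rw [stableDensity, dif_pos ⟨h0, h1⟩]
  exact (exists_isStableDensity h0 h1).choose_spec

/-! ### Lévy measures and upsilon transforms -/

/-- Lévy measures on `ℝ^d`: Borel measures `M` with `M {0} = 0` and `∫ (|x|² ∧ 1) M(dx) < ∞`. -/
structure IsLevyMeasure {d : ℕ} (M : Measure (EuclideanSpace ℝ (Fin d))) : Prop where
  zero : M {0} = 0
  lintegral_lt_top : ∫⁻ x, ENNReal.ofReal (min (‖x‖ ^ 2) 1) ∂M < ∞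

theorem IsLevyMeasure.sigmaFinite {d : ℕ} {M : Measure (EuclideanSpace ℝ (Fin d))}
    (hM : IsLevyMeasure M) : SigmaFinite M := by
  have hf : Measurable fun x : EuclideanSpace ℝ (Fin d) => ENNReal.ofReal (min (‖x‖ ^ 2) 1) := by
    fun_prop
  have hne : ∀ᵐ x ∂M, ENNReal.ofReal (min (‖x‖ ^ 2) 1) ≠ 0 := by
    filter_upwards [measure_eq_zero_iff_ae_notMem.1 hM.zero] with x hx
    have hx0 : 0 < ‖x‖ := norm_pos_iff.2 (by simpa using hx)
    have : 0 < min (‖x‖ ^ 2) 1 := lt_min (by positivity) one_pos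
    exact (ENNReal.ofReal_pos.2 this).ne'
  have := isFiniteMeasure_withDensity hM.lintegral_lt_top.ne
  rw [← withDensity_inv_same₀ hf.aemeasurable hne
    (Eventually.of_forall fun _ => ENNReal.ofReal_ne_top)]
  refine SigmaFinite.withDensity_of_ne_top ?_
  refine (withDensity_absolutelyContinuous _ _).ae_le (hne.mono fun x hx => ?_)
  exact ENNReal.inv_ne_top.2 hx

/-- The upsilon transform `Υ_ρ M` with dilation measure `ρ` on `(0, ∞)`: the image of `ρ ⊗ M`
under `(s, x) ↦ s x`, that is, `[Υ_ρ M](B) = ∫_{(0, ∞)} M(s⁻¹ B) ρ(ds)`; see `upsilon_apply`. -/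
noncomputable def upsilon {d : ℕ} (ρ : Measure ℝ) (M : Measure (EuclideanSpace ℝ (Fin d))) :
    Measure (EuclideanSpace ℝ (Fin d)) :=
  ((ρ.restrict (Ioi 0)).prod M).map fun z => z.1 • z.2

theorem upsilon_apply {d : ℕ} (ρ : Measure ℝ) (M : Measure (EuclideanSpace ℝ (Fin d)))
    [SigmaFinite M] {B : Set (EuclideanSpace ℝ (Fin d))} (hB : MeasurableSet B) :
    upsilon ρ M B = ∫⁻ s in Ioi (0 : ℝ), M (s⁻¹ • B) ∂ρ := by
  have hm : Measurable fun z : ℝ × EuclideanSpace ℝ (Fin d) => z.1 • z.2 := by fun_prop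
  rw [upsilon, Measure.map_apply hm hB, Measure.prod_apply (hm hB)]
  refine setLIntegral_congr_fun measurableSet_Ioi fun s hs => ?_
  have hs0 : s ≠ 0 := ne_of_gt hs
  congr 1
  ext x
  rw [mem_inv_smul_set_iff₀ hs0]
  rfl

/-- The domain `𝔇(Υ_ρ)`: the Lévy measures `M` on `ℝ^d` for which `Υ_ρ M` is a Lévy measure. -/
def upsilonDomain (d : ℕ) (ρ : Measure ℝ) : Set (Measure (EuclideanSpace ℝ (Fin d))) :=
  {M | IsLevyMeasure M ∧ IsLevyMeasure (upsilon ρ M)}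

/-- The range `ℜ(Υ_ρ)`: the Lévy measures `M` of the form `M = Υ_ρ M'` with `M' ∈ 𝔇(Υ_ρ)`. -/
def upsilonRange (d : ℕ) (ρ : Measure ℝ) : Set (Measure (EuclideanSpace ℝ (Fin d))) :=
  {M | IsLevyMeasure M ∧ ∃ M' ∈ upsilonDomain d ρ, M = upsilon ρ M'}

/-! ### The three families of dilation measures -/

/-- `ψ_{α,p}(ds) = s^{-α-1} e^{-s^p} 1_{s>0} ds`. -/
noncomputable def psi (α p : ℝ) : Measure ℝ :=
  (volume.restrict (Ioi 0)).withDensity fun s =>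
    ENNReal.ofReal (s ^ (-α - 1) * Real.exp (-s ^ p))

/-- The constant `K_{α,β,p} = ∫_0^∞ u^{α-β-1} e^{-u^p} du`. -/
noncomputable def tauConst (α β p : ℝ) : ℝ :=
  ∫ u in Ioi (0 : ℝ), u ^ (α - β - 1) * Real.exp (-u ^ p)

/-- `τ_{β→α,p}(ds) = K_{α,β,p}⁻¹ s^{-α-1} (1 - s^p)^{(α-β)/p-1} 1_{0<s<1} ds`. -/
noncomputable def tau (β α p : ℝ) : Measure ℝ :=
  (volume.restrict (Ioo 0 1)).withDensity fun s =>
    ENNReal.ofReal (1 / tauConst α β p * s ^ (-α - 1) * (1 - s ^ p) ^ ((α - β) / p - 1))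

/-- `π_{α,p→q}(ds) = p f_{q/p}(s^{-p}) s^{-α-p-1} 1_{s>0} ds`. -/
noncomputable def piMeasure (α p q : ℝ) : Measure ℝ :=
  (volume.restrict (Ioi 0)).withDensity fun s =>
    ENNReal.ofReal (p * stableDensity (q / p) (s ^ (-p)) * s ^ (-α - p - 1))

end

end UpsilonTransform

namespace UpsilonTransform

open MeasureTheory Set Filter Topology
open scoped ENNReal Pointwise

/-! ### Truncated squares and their dilation integrals -/

/-! Put D_ρ(u) = ∫ ((su)² ∧ 1) ρ(ds). By Tonelli the truncated second moment of Υ_ρ M is ∫ D_ρ(|x|)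
M(dx), so for a Lévy measure M membership in 𝔇(Υ_ρ) means that this integral is finite. If M =
Υ_{ρ'} M' is Lévy, then ∫ D_{ρ'}(|x|) M'(dx) < ∞, and Υ_ρ M is Lévy as soon as ∫ D_{ρ'}(su) ρ(ds) ≤
C D_{ρ'}(u) with C independent of u ≥ 0.

To obtain this bound, D_{ρ'} is replaced by the model J_a(u) = ∫_0^1 ((tu)² ∧ 1) t^{-a-1} dt, where
a is the order of ρ' at the origin: `HasPowerOrder.dilationIntegral_le` and
`HasPowerOrder.powerIntegral_le` give two-sided comparability. The model scales well: J_a(su) is at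
most s^a J_a(u) for s ≤ 1 and at most s² J_a(u) for s ≥ 1. Hence the bound holds whenever ∫_{(0,1)}
s^a ρ(ds) and ∫_{[1,∞)} s² ρ(ds) are finite; this is `upsilonRange_subset_upsilonDomain`. All
inequalities live in [0, ∞], so a ≥ 2, where J_a(u) = ∞ for u > 0, needs no separate treatment.

Each inclusion then compares two orders at the origin. The measures ψ_{α,p} and τ_{β→α,p} have order
α, and π_{α,p→q} has order α - q. The order of ρ' must exceed that of ρ, which is exactly β < α, 0 <
q or r < q.

For π the stable density is known only through its Laplace transform, which yields masses of
geometric windows rather than pointwise asymptotics; this is why order is measured by windows. The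
estimates behind it are `stableMeasure_Ici_le`, `le_stableMeasure_Ioc` and the moment bounds that
follow them. -/

/-- The truncated square `v² ∧ 1`, with values in `[0, ∞]`. -/
noncomputable def truncSq (v : ℝ) : ℝ≥0∞ := ENNReal.ofReal (min (v ^ 2) 1)

@[fun_prop]
theorem measurable_truncSq : Measurable truncSq := by unfold truncSq; fun_prop

theorem truncSq_mono {u v : ℝ} (hu : 0 ≤ u) (huv : u ≤ v) : truncSq u ≤ truncSq v :=
  ENNReal.ofReal_le_ofReal (min_le_min_right _ (pow_le_pow_left₀ hu huv 2))

theorem truncSq_mul_le {s : ℝ} (hs : 1 ≤ s) (v : ℝ) :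
    truncSq (s * v) ≤ ENNReal.ofReal (s ^ 2) * truncSq v := by
  rw [truncSq, truncSq, ← ENNReal.ofReal_mul (by positivity)]
  refine ENNReal.ofReal_le_ofReal ?_
  have h1 : 1 ≤ s ^ 2 := one_le_pow₀ hs
  rw [mul_min_of_nonneg _ _ (by positivity), mul_pow]
  exact min_le_min_left _ (by linarith)

/-- `∫_{(0, ∞)} ((s u)² ∧ 1) ρ(ds)`. -/
noncomputable def dilationIntegral (ρ : Measure ℝ) (u : ℝ) : ℝ≥0∞ :=
  ∫⁻ s in Ioi (0 : ℝ), truncSq (s * u) ∂ρ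

/-- `∫_0^1 ((t u)² ∧ 1) t^{-a-1} dt`. -/
noncomputable def powerIntegral (a u : ℝ) : ℝ≥0∞ :=
  ∫⁻ t in Ioo (0 : ℝ) 1, truncSq (t * u) * ENNReal.ofReal (t ^ (-a - 1))

/-- A power map distorts by at most A^|e| on a symmetric geometric window. Using |e| keeps later
estimates free of a case distinction on the sign of the exponent. -/
theorem rpow_mem_Icc {A x : ℝ} (e : ℝ) (hA : 1 ≤ A) (hx : x ∈ Icc A⁻¹ A) :
    x ^ e ∈ Icc (A ^ (-|e|)) (A ^ |e|) := by
  have hA0 : 0 < A := by linarith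
  have hi : 0 < A⁻¹ := inv_pos.2 hA0
  have hx0 : 0 < x := hi.trans_le hx.1
  rcases le_total 0 e with he | he
  · rw [abs_of_nonneg he, Real.rpow_neg hA0.le, ← Real.inv_rpow hA0.le]
    exact ⟨Real.rpow_le_rpow hi.le hx.1 he, Real.rpow_le_rpow hx0.le hx.2 he⟩
  · rw [abs_of_nonpos he, neg_neg, Real.rpow_neg hA0.le, ← Real.inv_rpow hA0.le]
    exact ⟨Real.rpow_le_rpow_of_nonpos hx0 hx.2 he, Real.rpow_le_rpow_of_nonpos hi hx.1 he⟩

/-- Substituting t → t/s pulls out the factor s^a exactly and leaves the integral over (0, s), which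
is then enlarged to (0, 1). -/
theorem powerIntegral_mul_le_rpow {a s : ℝ} (hs : 0 < s) (hs1 : s ≤ 1) (u : ℝ) :
    powerIntegral a (s * u) ≤ ENNReal.ofReal (s ^ a) * powerIntegral a u := by
  have himg : (fun t : ℝ => s * t) '' Ioo 0 1 = Ioo 0 s := by
    rw [image_mul_left_Ioo hs]; simp
  have h := lintegral_image_eq_lintegral_abs_deriv_mul (s := Ioo (0 : ℝ) 1) (f := fun t => s * t)
    (f' := fun _ => s) measurableSet_Ioo
    (fun x _ => by simpa using ((hasDerivAt_id x).const_mul s).hasDerivWithinAt)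
    (mul_right_injective₀ hs.ne').injOn
    (fun t => truncSq (t * u) * ENNReal.ofReal (t ^ (-a - 1)))
  rw [himg] at h
  have h2 : powerIntegral a (s * u) = ENNReal.ofReal (s ^ a) *
      ∫⁻ t in Ioo 0 s, truncSq (t * u) * ENNReal.ofReal (t ^ (-a - 1)) := by
    rw [h, ← lintegral_const_mul _ (by fun_prop), powerIntegral]
    refine setLIntegral_congr_fun measurableSet_Ioo fun t ht => ?_
    rw [abs_of_pos hs, mul_left_comm (ENNReal.ofReal s),
      mul_left_comm (ENNReal.ofReal (s ^ a)),
      ← ENNReal.ofReal_mul hs.le, ← ENNReal.ofReal_mul (by positivity),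
      Real.mul_rpow hs.le ht.1.le]
    congr 2
    · ring_nf
    · rw [Real.rpow_sub_one hs.ne', Real.rpow_neg hs.le]
      have := (Real.rpow_pos_of_pos hs a).ne'
      field_simp
  rw [h2]
  gcongr
  exact lintegral_mono_set (Ioo_subset_Ioo_right hs1)

theorem powerIntegral_mul_le_sq {a s : ℝ} (hs : 1 ≤ s) (u : ℝ) :
    powerIntegral a (s * u) ≤ ENNReal.ofReal (s ^ 2) * powerIntegral a u := by
  rw [powerIntegral, powerIntegral, ← lintegral_const_mul _ (by fun_prop)]
  refine lintegral_mono fun t => ?_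
  rw [mul_left_comm t, ← mul_assoc (ENNReal.ofReal _)]
  gcongr
  exact truncSq_mul_le hs _

theorem truncSq_le_powerIntegral (a : ℝ) : ∃ C : ℝ≥0∞, C ≠ ∞ ∧
    ∀ u, 0 ≤ u → truncSq u ≤ C * powerIntegral a u := by
  have hc : (0 : ℝ) < 2 ^ (-|-a - 1|) := by positivity
  -- Only t in (1/2, 1) is used: 8 = 4 · 2, with 4 from passing from u/2 to u and 2 from the length
  -- of the interval. The remaining factor bounds t^{-a-1} from below there.
  refine ⟨8 * (ENNReal.ofReal (2 ^ (-|-a - 1|)))⁻¹,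
    ENNReal.mul_ne_top (by simp) (ENNReal.inv_ne_top.2 (ENNReal.ofReal_pos.2 hc).ne'),
    fun u hu => ?_⟩
  set c := ENNReal.ofReal (2 ^ (-|-a - 1|)) with hcd
  have h1 : truncSq (u / 2) * c * ENNReal.ofReal (1 / 2) ≤ powerIntegral a u := by
    calc truncSq (u / 2) * c * ENNReal.ofReal (1 / 2)
        = ∫⁻ t in Ioo (1 / 2 : ℝ) 1, truncSq (u / 2) * c := by
          rw [setLIntegral_const, Real.volume_Ioo]; norm_num
      _ ≤ ∫⁻ t in Ioo (1 / 2 : ℝ) 1, truncSq (t * u) * ENNReal.ofReal (t ^ (-a - 1)) := by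
          refine setLIntegral_mono' measurableSet_Ioo fun t ht => ?_
          gcongr
          · exact truncSq_mono (by positivity) (by nlinarith [ht.1])
          · exact ENNReal.ofReal_le_ofReal (rpow_mem_Icc _ one_le_two
              ⟨by have := ht.1; norm_num at this ⊢; linarith, by linarith [ht.2]⟩).1
      _ ≤ powerIntegral a u := lintegral_mono_set (Ioo_subset_Ioo_left (by norm_num))
  have h2 : truncSq u ≤ 4 * truncSq (u / 2) := by
    have := truncSq_mul_le one_le_two (u / 2)
    rwa [mul_div_cancel₀ _ two_ne_zero, show ENNReal.ofReal (2 ^ 2) = 4 by norm_num] at this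
  have hh : ENNReal.ofReal (1 / 2) * 2 = 1 := by
    rw [← ENNReal.ofReal_ofNat, ← ENNReal.ofReal_mul (by norm_num)]; norm_num
  have hcc : c * c⁻¹ = 1 := ENNReal.mul_inv_cancel (ENNReal.ofReal_pos.2 hc).ne' ENNReal.ofReal_ne_top
  calc truncSq u ≤ 4 * truncSq (u / 2) := h2
    _ = 8 * c⁻¹ * (truncSq (u / 2) * c * ENNReal.ofReal (1 / 2)) := by
        calc 4 * truncSq (u / 2) = 4 * truncSq (u / 2) * (c * c⁻¹) * (ENNReal.ofReal (1 / 2) * 2) := by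
              rw [hcc, hh, mul_one, mul_one]
          _ = _ := by ring
    _ ≤ _ := by gcongr

/-! ### Measures of regular order at the origin -/

/-- The measure `ρ` behaves near the origin like `s^{-a-1} ds`, as far as the masses of geometric
windows can tell, and has a finite second moment away from the origin. -/
structure HasPowerOrder (a : ℝ) (ρ : Measure ℝ) : Prop where
  upper : ∃ C : ℝ≥0∞, C ≠ ∞ ∧ ∀ t ∈ Ioo (0 : ℝ) (1 / 2),
    ρ (Ico (t / 2) t) ≤ C * ENNReal.ofReal (t ^ (-a))
  lower : ∃ A : ℝ, 1 ≤ A ∧ ∃ C : ℝ≥0∞, C ≠ ∞ ∧ ∀ t ∈ Ioo (0 : ℝ) 1,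
    ENNReal.ofReal (t ^ (-a)) ≤ C * ρ (Ico (t / A) t)
  tail : ∫⁻ s in Ici (1 / 4 : ℝ), ENNReal.ofReal (s ^ 2) ∂ρ ≠ ∞

/-- Tonelli, since t/A ≤ s < t is the same as s < t ≤ As. This turns information on window masses
into information on integrals against ρ. -/
theorem lintegral_window_swap (ρ : Measure ℝ) [SFinite ρ] {A b : ℝ} (hA : 1 ≤ A) {g : ℝ → ℝ≥0∞}
    (hg : Measurable g) :
    ∫⁻ t in Ioo 0 b, g t * ρ (Ico (t / A) t)
      = ∫⁻ s in Ioi 0, (∫⁻ t in Ioc s (A * s) ∩ Iio b, g t) ∂ρ := by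
  have hA0 : 0 < A := by linarith
  have hm : MeasurableSet ({z : ℝ × ℝ | z.1 / A ≤ z.2} ∩ {z : ℝ × ℝ | z.2 < z.1}) :=
    (measurableSet_le (by fun_prop) (by fun_prop)).inter
      (measurableSet_lt (by fun_prop) (by fun_prop))
  have e1 : ∀ t ∈ Ioo 0 b, g t * ρ (Ico (t / A) t) = ∫⁻ s in Ioi 0,
      ({z : ℝ × ℝ | z.1 / A ≤ z.2} ∩ {z : ℝ × ℝ | z.2 < z.1}).indicator (fun z => g z.1) (t, s) ∂ρ := by
    intro t ht
    have : ∀ s, ({z : ℝ × ℝ | z.1 / A ≤ z.2} ∩ {z : ℝ × ℝ | z.2 < z.1}).indicator (fun z => g z.1) (t, s)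
        = (Ico (t / A) t).indicator (fun _ => g t) s := fun s => rfl
    simp only [this]
    rw [setLIntegral_indicator measurableSet_Ico, setLIntegral_const, inter_eq_left.2]
    exact fun s hs => (div_pos ht.1 hA0).trans_le hs.1
  rw [setLIntegral_congr_fun measurableSet_Ioo e1, lintegral_lintegral_swap]
  · refine setLIntegral_congr_fun measurableSet_Ioi fun s hs => ?_
    have hs0 : (0 : ℝ) < s := hs
    have : ∀ t, ({z : ℝ × ℝ | z.1 / A ≤ z.2} ∩ {z : ℝ × ℝ | z.2 < z.1}).indicator (fun z => g z.1) (t, s)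
        = (Ioc s (A * s)).indicator g t := by
      intro t
      simp only [indicator, mem_inter_iff, mem_ofPred_eq, mem_Ioc, div_le_iff₀' hA0, and_comm]
    simp only [this]
    rw [setLIntegral_indicator measurableSet_Ioc]
    congr 2
    ext t
    simp only [mem_inter_iff, mem_Ioc, mem_Ioo, mem_Iio]
    constructor
    · rintro ⟨h1, h2⟩; exact ⟨h1, h2.2⟩
    · rintro ⟨h1, h2⟩; exact ⟨h1, hs0.trans h1.1, h2⟩
  · exact ((hg.comp measurable_fst).indicator hm).aemeasurable

/-- For small s, the value at s is dominated by an average over t in (s, 2s] with weight 2/t,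
because the truncated square is increasing. Exchanging the integrals produces window masses, which
the upper bound compares with t^{-a}. Large s contribute only a multiple of u² ∧ 1. -/
theorem HasPowerOrder.dilationIntegral_le {a : ℝ} {ρ : Measure ℝ} [SFinite ρ]
    (h : HasPowerOrder a ρ) : ∃ C : ℝ≥0∞, C ≠ ∞ ∧
      ∀ u, 0 ≤ u → dilationIntegral ρ u ≤ C * powerIntegral a u := by
  obtain ⟨C, hC, hup⟩ := h.upper
  obtain ⟨D, hD, hk⟩ := truncSq_le_powerIntegral a
  refine ⟨2 * C + 16 * (∫⁻ s in Ici (1 / 4 : ℝ), ENNReal.ofReal (s ^ 2) ∂ρ) * D,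
    ENNReal.add_ne_top.2 ⟨ENNReal.mul_ne_top (by simp) hC,
      ENNReal.mul_ne_top (ENNReal.mul_ne_top (by simp) h.tail) hD⟩, fun u hu => ?_⟩
  -- The cut at 1/4 keeps (s, 2s] inside (0, 1/2), the range where the window bound is assumed.
  have hsplit : Ioi (0 : ℝ) = Ioo 0 (1 / 4) ∪ Ici (1 / 4) :=
    (Ioo_union_Ici_eq_Ioi (by norm_num)).symm
  have hsmall : ∫⁻ s in Ioo 0 (1 / 4), truncSq (s * u) ∂ρ ≤ 2 * C * powerIntegral a u := by
    calc ∫⁻ s in Ioo 0 (1 / 4), truncSq (s * u) ∂ρ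
        ≤ ∫⁻ s in Ioo 0 (1 / 4), (∫⁻ t in Ioc s (2 * s) ∩ Iio (1 / 2),
            truncSq (t * u) * ENNReal.ofReal (2 / t)) ∂ρ := by
          refine setLIntegral_mono' measurableSet_Ioo fun s hs => ?_
          have hs0 : 0 < s := hs.1
          have hsub : Ioc s (2 * s) ∩ Iio (1 / 2) = Ioc s (2 * s) :=
            inter_eq_left.2 fun t ht => show t < 1 / 2 by linarith [ht.2, hs.2]
          rw [hsub]
          calc truncSq (s * u) = ∫⁻ t in Ioc s (2 * s), truncSq (s * u) * ENNReal.ofReal (1 / s) := by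
                rw [setLIntegral_const, Real.volume_Ioc, mul_assoc,
                  ← ENNReal.ofReal_mul (by positivity)]
                rw [show 1 / s * (2 * s - s) = 1 by field_simp; ring]; simp
            _ ≤ _ := by
                refine setLIntegral_mono' measurableSet_Ioc fun t ht => ?_
                have ht0 : 0 < t := hs0.trans ht.1
                refine mul_le_mul' (truncSq_mono (by positivity) (by nlinarith [ht.1]))
                  (ENNReal.ofReal_le_ofReal ?_)
                rw [div_le_div_iff₀ hs0 ht0]; linarith [ht.2]
      _ ≤ ∫⁻ s in Ioi 0, (∫⁻ t in Ioc s (2 * s) ∩ Iio (1 / 2),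
            truncSq (t * u) * ENNReal.ofReal (2 / t)) ∂ρ := lintegral_mono_set fun s hs => hs.1
      _ = ∫⁻ t in Ioo 0 (1 / 2), truncSq (t * u) * ENNReal.ofReal (2 / t) * ρ (Ico (t / 2) t) :=
          (lintegral_window_swap ρ one_le_two (by fun_prop)).symm
      _ ≤ ∫⁻ t in Ioo 0 (1 / 2), 2 * C * (truncSq (t * u) * ENNReal.ofReal (t ^ (-a - 1))) := by
          refine setLIntegral_mono' measurableSet_Ioo fun t ht => ?_
          have ht0 : 0 < t := ht.1
          calc _ ≤ truncSq (t * u) * ENNReal.ofReal (2 / t) * (C * ENNReal.ofReal (t ^ (-a))) := by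
                gcongr; exact hup t ht
            _ = C * truncSq (t * u) * (ENNReal.ofReal (2 / t) * ENNReal.ofReal (t ^ (-a))) := by ring
            _ = C * truncSq (t * u) * (2 * ENNReal.ofReal (t ^ (-a - 1))) := by
                rw [← ENNReal.ofReal_mul (by positivity), ← ENNReal.ofReal_ofNat 2,
                  ← ENNReal.ofReal_mul (by norm_num), Real.rpow_sub_one ht0.ne']
                congr 2; ring
            _ = _ := by ring
      _ = 2 * C * ∫⁻ t in Ioo 0 (1 / 2), truncSq (t * u) * ENNReal.ofReal (t ^ (-a - 1)) :=
          lintegral_const_mul _ (by fun_prop)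
      _ ≤ _ := by
          gcongr
          exact lintegral_mono_set (Ioo_subset_Ioo_right (by norm_num))
  have hlarge : ∫⁻ s in Ici (1 / 4), truncSq (s * u) ∂ρ ≤
      16 * (∫⁻ s in Ici (1 / 4 : ℝ), ENNReal.ofReal (s ^ 2) ∂ρ) * D * powerIntegral a u := by
    calc ∫⁻ s in Ici (1 / 4), truncSq (s * u) ∂ρ
        ≤ ∫⁻ s in Ici (1 / 4), ENNReal.ofReal (s ^ 2) * (16 * truncSq u) ∂ρ := by
          refine setLIntegral_mono' measurableSet_Ici fun s hs => ?_
          have hs4 : 1 / 4 ≤ s := hs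
          calc truncSq (s * u) = truncSq (4 * s * (u / 4)) := by congr 1; ring
            _ ≤ ENNReal.ofReal ((4 * s) ^ 2) * truncSq (u / 4) := truncSq_mul_le (by linarith) _
            _ ≤ ENNReal.ofReal ((4 * s) ^ 2) * truncSq u := by
                gcongr; exact truncSq_mono (by positivity) (by linarith)
            _ = _ := by
                rw [mul_pow, mul_comm (4 ^ 2 : ℝ), ENNReal.ofReal_mul (by positivity), mul_assoc]
                norm_num
      _ = (∫⁻ s in Ici (1 / 4), ENNReal.ofReal (s ^ 2) ∂ρ) * (16 * truncSq u) :=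
          lintegral_mul_const _ (by fun_prop)
      _ ≤ (∫⁻ s in Ici (1 / 4), ENNReal.ofReal (s ^ 2) ∂ρ) * (16 * (D * powerIntegral a u)) := by
          gcongr; exact hk u hu
      _ = _ := by ring
  rw [dilationIntegral, hsplit, add_mul]
  exact (lintegral_union_le _ _ _).trans (add_le_add hsmall hlarge)

/-- The converse averaging: t^{-a} is replaced by the mass of [t/A, t). After the exchange, t ranges
over (s, As], where the truncated square at t exceeds that at s by a factor of at most A². -/
theorem HasPowerOrder.powerIntegral_le {a : ℝ} {ρ : Measure ℝ} [SFinite ρ]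
    (h : HasPowerOrder a ρ) : ∃ C : ℝ≥0∞, C ≠ ∞ ∧
      ∀ u, 0 ≤ u → powerIntegral a u ≤ C * dilationIntegral ρ u := by
  obtain ⟨A, hA, C, hC, hlow⟩ := h.lower
  have hA0 : 0 < A := by linarith
  refine ⟨C * (ENNReal.ofReal (A ^ 2) * ENNReal.ofReal (A - 1)), ENNReal.mul_ne_top hC
    (ENNReal.mul_ne_top ENNReal.ofReal_ne_top ENNReal.ofReal_ne_top), fun u hu => ?_⟩
  calc powerIntegral a u
      ≤ ∫⁻ t in Ioo 0 1, C * (truncSq (t * u) * ENNReal.ofReal (1 / t) * ρ (Ico (t / A) t)) := by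
        refine setLIntegral_mono' measurableSet_Ioo fun t ht => ?_
        have ht0 : 0 < t := ht.1
        calc truncSq (t * u) * ENNReal.ofReal (t ^ (-a - 1))
            = truncSq (t * u) * ENNReal.ofReal (1 / t) * ENNReal.ofReal (t ^ (-a)) := by
              rw [mul_assoc, ← ENNReal.ofReal_mul (by positivity), Real.rpow_sub_one ht0.ne']
              congr 2; ring
          _ ≤ truncSq (t * u) * ENNReal.ofReal (1 / t) * (C * ρ (Ico (t / A) t)) := by
              gcongr; exact hlow t ht
          _ = _ := by ring
    _ = C * ∫⁻ t in Ioo 0 1, truncSq (t * u) * ENNReal.ofReal (1 / t) * ρ (Ico (t / A) t) :=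
        lintegral_const_mul' _ _ hC
    _ = C * ∫⁻ s in Ioi 0, (∫⁻ t in Ioc s (A * s) ∩ Iio 1,
          truncSq (t * u) * ENNReal.ofReal (1 / t)) ∂ρ := by
        rw [lintegral_window_swap ρ hA (by fun_prop)]
    _ ≤ C * ∫⁻ s in Ioi 0, ENNReal.ofReal (A ^ 2) * ENNReal.ofReal (A - 1) * truncSq (s * u) ∂ρ := by
        gcongr C * ?_
        refine setLIntegral_mono' measurableSet_Ioi fun s hs => ?_
        have hs0 : (0 : ℝ) < s := hs
        calc ∫⁻ t in Ioc s (A * s) ∩ Iio 1, truncSq (t * u) * ENNReal.ofReal (1 / t)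
            ≤ ∫⁻ t in Ioc s (A * s), truncSq (t * u) * ENNReal.ofReal (1 / t) :=
              lintegral_mono_set inter_subset_left
          _ ≤ ∫⁻ t in Ioc s (A * s), truncSq (A * (s * u)) * ENNReal.ofReal (1 / s) := by
              refine setLIntegral_mono' measurableSet_Ioc fun t ht => ?_
              have ht0 : 0 < t := hs0.trans ht.1
              gcongr
              · exact truncSq_mono (by positivity) (by nlinarith [ht.2])
              · exact ht.1.le
          _ = truncSq (A * (s * u)) * ENNReal.ofReal (A - 1) := by
              rw [setLIntegral_const, Real.volume_Ioc, mul_assoc, ← ENNReal.ofReal_mul (by positivity)]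
              congr 2; field_simp
          _ ≤ ENNReal.ofReal (A ^ 2) * truncSq (s * u) * ENNReal.ofReal (A - 1) := by
              gcongr; exact truncSq_mul_le hA _
          _ = _ := by ring
    _ = _ := by
        rw [lintegral_const_mul _ (by fun_prop), dilationIntegral]
        ring

/-! ### Inclusions between ranges and domains -/

theorem lintegral_upsilon {d : ℕ} (ρ : Measure ℝ) (M : Measure (EuclideanSpace ℝ (Fin d)))
    [SFinite M] {f : EuclideanSpace ℝ (Fin d) → ℝ≥0∞} (hf : Measurable f) :
    ∫⁻ x, f x ∂(upsilon ρ M) = ∫⁻ s in Ioi (0 : ℝ), (∫⁻ x, f (s • x) ∂M) ∂ρ := by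
  have hm : Measurable fun z : ℝ × EuclideanSpace ℝ (Fin d) => z.1 • z.2 := by fun_prop
  rw [upsilon, lintegral_map hf hm, lintegral_prod (fun z => f (z.1 • z.2)) (hf.comp hm).aemeasurable]

theorem IsLevyMeasure.upsilon_singleton_zero {d : ℕ} {M : Measure (EuclideanSpace ℝ (Fin d))}
    (hM : IsLevyMeasure M) (ρ : Measure ℝ) : upsilon ρ M {0} = 0 := by
  have := hM.sigmaFinite
  rw [upsilon_apply ρ M (measurableSet_singleton 0)]
  simp [hM.zero]

theorem lintegral_truncSq_upsilon {d : ℕ} (ρ : Measure ℝ) [SFinite ρ]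
    (M : Measure (EuclideanSpace ℝ (Fin d))) [SFinite M] :
    ∫⁻ x, truncSq ‖x‖ ∂(upsilon ρ M) = ∫⁻ x, dilationIntegral ρ ‖x‖ ∂M := by
  rw [lintegral_upsilon ρ M (by fun_prop), lintegral_lintegral_swap]
  · refine lintegral_congr fun x => ?_
    refine setLIntegral_congr_fun measurableSet_Ioi fun s hs => ?_
    simp only [norm_smul, Real.norm_of_nonneg (le_of_lt (mem_Ioi.1 hs))]
  · exact Measurable.aemeasurable (by fun_prop)

theorem measurable_dilationIntegral (ρ : Measure ℝ) [SFinite ρ] :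
    Measurable (dilationIntegral ρ) :=
  Measurable.lintegral_prod_right' (f := fun z : ℝ × ℝ => truncSq (z.2 * z.1)) (by fun_prop)

theorem lintegral_powerIntegral_le {a : ℝ} {ρ : Measure ℝ}
    (h0 : ∫⁻ s in Ioo (0 : ℝ) 1, ENNReal.ofReal (s ^ a) ∂ρ ≠ ∞)
    (h1 : ∫⁻ s in Ici (1 : ℝ), ENNReal.ofReal (s ^ 2) ∂ρ ≠ ∞) : ∃ C : ℝ≥0∞, C ≠ ∞ ∧
      ∀ u, ∫⁻ s in Ioi (0 : ℝ), powerIntegral a (s * u) ∂ρ ≤ C * powerIntegral a u := by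
  -- The constant is the sum of the two integrals assumed finite, one for each scaling regime of
  -- `powerIntegral`.
  refine ⟨_, ENNReal.add_ne_top.2 ⟨h0, h1⟩, fun u => ?_⟩
  rw [← Ioo_union_Ici_eq_Ioi zero_lt_one, add_mul]
  refine (lintegral_union_le _ _ _).trans (add_le_add ?_ ?_)
  · rw [← lintegral_mul_const _ (by fun_prop)]
    exact setLIntegral_mono' measurableSet_Ioo fun s hs =>
      powerIntegral_mul_le_rpow hs.1 hs.2.le u
  · rw [← lintegral_mul_const _ (by fun_prop)]
    exact setLIntegral_mono' measurableSet_Ici fun s hs => powerIntegral_mul_le_sq hs u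

theorem upsilonRange_subset_upsilonDomain (d : ℕ) {a : ℝ} {ρ ρ' : Measure ℝ} [SFinite ρ] [SFinite ρ']
    (h : HasPowerOrder a ρ')
    (h0 : ∫⁻ s in Ioo (0 : ℝ) 1, ENNReal.ofReal (s ^ a) ∂ρ ≠ ∞)
    (h1 : ∫⁻ s in Ici (1 : ℝ), ENNReal.ofReal (s ^ 2) ∂ρ ≠ ∞) :
    upsilonRange d ρ' ⊆ upsilonDomain d ρ := by
  rintro M ⟨hM, M', ⟨hM', -⟩, rfl⟩
  refine ⟨hM, hM.upsilon_singleton_zero ρ, ?_⟩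
  have := hM.sigmaFinite
  have := hM'.sigmaFinite
  obtain ⟨C₁, hC₁, hle₁⟩ := h.dilationIntegral_le
  obtain ⟨C₂, hC₂, hle₂⟩ := lintegral_powerIntegral_le h0 h1
  obtain ⟨C₃, hC₃, hle₃⟩ := h.powerIntegral_le
  have hfin : ∫⁻ x, dilationIntegral ρ' ‖x‖ ∂M' ≠ ∞ := by
    rw [← lintegral_truncSq_upsilon]
    exact hM.lintegral_lt_top.ne
  have hmeas := measurable_dilationIntegral ρ'
  change ∫⁻ x, truncSq ‖x‖ ∂(upsilon ρ (upsilon ρ' M')) < ∞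
  -- Pass from D_{ρ'} to the model, apply the scaling bound there, and return to D_{ρ'}.
  have key : ∀ u : ℝ, 0 ≤ u → ∫⁻ s in Ioi (0 : ℝ), dilationIntegral ρ' (s * u) ∂ρ
      ≤ C₁ * (C₂ * (C₃ * dilationIntegral ρ' u)) := fun u hu => by
    calc ∫⁻ s in Ioi (0 : ℝ), dilationIntegral ρ' (s * u) ∂ρ
        ≤ ∫⁻ s in Ioi (0 : ℝ), C₁ * powerIntegral a (s * u) ∂ρ :=
          setLIntegral_mono' measurableSet_Ioi fun s hs =>
            hle₁ _ (mul_nonneg (le_of_lt (mem_Ioi.1 hs)) hu)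
      _ = C₁ * ∫⁻ s in Ioi (0 : ℝ), powerIntegral a (s * u) ∂ρ := lintegral_const_mul' _ _ hC₁
      _ ≤ _ := by
          gcongr
          refine (hle₂ u).trans ?_
          gcongr
          exact hle₃ u hu
  calc ∫⁻ x, truncSq ‖x‖ ∂(upsilon ρ (upsilon ρ' M'))
      = ∫⁻ s in Ioi (0 : ℝ), (∫⁻ x, truncSq ‖s • x‖ ∂(upsilon ρ' M')) ∂ρ :=
        lintegral_upsilon ρ _ (by fun_prop)
    _ = ∫⁻ s in Ioi (0 : ℝ), (∫⁻ x, dilationIntegral ρ' (s * ‖x‖) ∂M') ∂ρ := by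
        refine setLIntegral_congr_fun measurableSet_Ioi fun s hs => ?_
        rw [lintegral_upsilon ρ' M' (by fun_prop), lintegral_lintegral_swap]
        · refine lintegral_congr fun x => setLIntegral_congr_fun measurableSet_Ioi fun t ht => ?_
          simp only [norm_smul, Real.norm_of_nonneg (le_of_lt (mem_Ioi.1 hs)),
            Real.norm_of_nonneg (le_of_lt (mem_Ioi.1 ht))]
          ring_nf
        · exact Measurable.aemeasurable (by fun_prop)
    _ = ∫⁻ x, (∫⁻ s in Ioi (0 : ℝ), dilationIntegral ρ' (s * ‖x‖) ∂ρ) ∂M' :=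
        lintegral_lintegral_swap (Measurable.aemeasurable (hmeas.comp
          (g := dilationIntegral ρ') (f := fun z : ℝ × EuclideanSpace ℝ (Fin d) => z.1 * ‖z.2‖)
          (by fun_prop)))
    _ ≤ ∫⁻ x, C₁ * (C₂ * (C₃ * dilationIntegral ρ' ‖x‖)) ∂M' :=
        lintegral_mono fun x => key _ (norm_nonneg x)
    _ = C₁ * (C₂ * (C₃ * ∫⁻ x, dilationIntegral ρ' ‖x‖ ∂M')) := by
        rw [lintegral_const_mul' _ _ hC₁, lintegral_const_mul' _ _ hC₂, lintegral_const_mul' _ _ hC₃]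
    _ < ∞ := by
        rw [lt_top_iff_ne_top]
        exact ENNReal.mul_ne_top hC₁ (ENNReal.mul_ne_top hC₂ (ENNReal.mul_ne_top hC₃ hfin))

/-! ### The dilation measures with elementary densities -/

theorem rpow_mem_Icc_mul {A s t : ℝ} (e : ℝ) (hA : 1 ≤ A) (ht : 0 < t) (hs : s ∈ Icc (t / A) (A * t)) :
    s ^ e ∈ Icc (A ^ (-|e|) * t ^ e) (A ^ |e| * t ^ e) := by
  have hA0 : 0 < A := by linarith
  have hs0 : 0 < s := (div_pos ht hA0).trans_le hs.1
  have h := rpow_mem_Icc (x := s / t) e hA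
    ⟨by rw [le_div_iff₀ ht, inv_mul_eq_div]; exact hs.1, by rw [div_le_iff₀ ht]; exact hs.2⟩
  have hte : 0 < t ^ e := Real.rpow_pos_of_pos ht e
  rw [Real.div_rpow hs0.le ht.le, mem_Icc, le_div_iff₀ hte, div_le_iff₀ hte] at h
  exact h

theorem setLIntegral_withDensity_ne_top {S T : Set ℝ} (hT : MeasurableSet T)
    {f g : ℝ → ℝ} (hf : Measurable f) (hg : Measurable g) (hpos : ∀ s ∈ T ∩ S, 0 ≤ f s)
    (hST : MeasurableSet S) (h : IntegrableOn (fun s => f s * g s) (T ∩ S)) :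
    ∫⁻ s in T, ENNReal.ofReal (f s) ∂((volume.restrict S).withDensity fun s => ENNReal.ofReal (g s))
      ≠ ∞ := by
  rw [restrict_withDensity hT, Measure.restrict_restrict hT,
    lintegral_withDensity_eq_lintegral_mul _ hg.ennreal_ofReal hf.ennreal_ofReal,
    setLIntegral_congr_fun (g := fun s => ENNReal.ofReal (f s * g s)) (hT.inter hST)]
  · exact h.lintegral_lt_top.ne
  · intro s hs
    simp only [Pi.mul_apply]
    rw [ENNReal.ofReal_mul (hpos s hs), mul_comm]

/-- On a geometric window around t the density is comparable to t^{-a-1} and the length to t, so the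
mass is comparable to t^{-a}. -/
theorem hasPowerOrder_withDensity {a c C : ℝ} {S : Set ℝ} {g : ℝ → ℝ} (hS : Ioo 0 (1 / 2) ⊆ S)
    (hc : 0 < c) (hg : ∀ s ∈ Ioo (0 : ℝ) (1 / 2), g s ∈ Icc (c * s ^ (-a - 1)) (C * s ^ (-a - 1)))
    (htail : ∫⁻ s in Ici (1 / 4 : ℝ), ENNReal.ofReal (s ^ 2)
      ∂((volume.restrict S).withDensity fun s => ENNReal.ofReal (g s)) ≠ ∞) :
    HasPowerOrder a ((volume.restrict S).withDensity fun s => ENNReal.ofReal (g s)) := by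
  have hC : 0 < C := by
    have h := hg (1 / 4) ⟨by norm_num, by norm_num⟩
    have hp : (0 : ℝ) < (1 / 4) ^ (-a - 1) := by positivity
    exact hc.trans_le (le_of_mul_le_mul_right (h.1.trans h.2) hp)
  have hwin : ∀ u v : ℝ, 0 < u → v ≤ 1 / 2 →
      ((volume.restrict S).withDensity fun s => ENNReal.ofReal (g s)) (Ico u v)
        = ∫⁻ s in Ico u v, ENNReal.ofReal (g s) := by
    intro u v hu hv
    rw [withDensity_apply _ measurableSet_Ico, Measure.restrict_restrict measurableSet_Ico,
      inter_eq_left.2]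
    exact fun s hs => hS ⟨hu.trans_le hs.1, hs.2.trans_le hv⟩
  have hpow : ∀ t : ℝ, 0 < t → t ^ (-a) = t ^ (-a - 1) * t := fun t ht => by
    rw [Real.rpow_sub_one ht.ne']; field_simp
  refine ⟨⟨ENNReal.ofReal (C * 2 ^ |-a - 1|), ENNReal.ofReal_ne_top, fun t ht => ?_⟩,
    -- The ratio 4 leaves room to use only [t/4, t/2): t runs up to 1, but the density is controlled
    -- only below 1/2.
    ⟨4, by norm_num, ENNReal.ofReal (4 / (c * 4 ^ (-|-a - 1|))), ENNReal.ofReal_ne_top,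
      fun t ht => ?_⟩, htail⟩
  · have ht0 : 0 < t := ht.1
    rw [hwin _ _ (by positivity) ht.2.le]
    calc ∫⁻ s in Ico (t / 2) t, ENNReal.ofReal (g s)
        ≤ ∫⁻ s in Ico (t / 2) t, ENNReal.ofReal (C * (2 ^ |-a - 1| * t ^ (-a - 1))) := by
          refine setLIntegral_mono' measurableSet_Ico fun s hs => ENNReal.ofReal_le_ofReal ?_
          have hs0 : 0 < s := by linarith [hs.1]
          refine (hg s ⟨hs0, hs.2.trans ht.2⟩).2.trans ?_
          gcongr
          exact (rpow_mem_Icc_mul (-a - 1) one_le_two ht0 ⟨hs.1, by linarith [hs.2]⟩).2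
      _ ≤ _ := by
          rw [setLIntegral_const, Real.volume_Ico, ← ENNReal.ofReal_mul (by positivity),
            ← ENNReal.ofReal_mul (by positivity), hpow t ht0]
          refine ENNReal.ofReal_le_ofReal ?_
          rw [← mul_assoc, ← mul_assoc]
          gcongr
          linarith
  · have ht0 : 0 < t := ht.1
    calc ENNReal.ofReal (t ^ (-a))
        = ENNReal.ofReal (4 / (c * 4 ^ (-|-a - 1|))) *
          ∫⁻ s in Ico (t / 4) (t / 2), ENNReal.ofReal (c * (4 ^ (-|-a - 1|) * t ^ (-a - 1))) := by
          rw [setLIntegral_const, Real.volume_Ico, ← ENNReal.ofReal_mul (by positivity),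
            ← ENNReal.ofReal_mul (by positivity), hpow t ht0]
          congr 1
          have : (0 : ℝ) < 4 ^ (-|-a - 1|) := by positivity
          field_simp
          ring
      _ ≤ ENNReal.ofReal (4 / (c * 4 ^ (-|-a - 1|))) *
          ∫⁻ s in Ico (t / 4) (t / 2), ENNReal.ofReal (g s) := by
          refine mul_le_mul_right (setLIntegral_mono' measurableSet_Ico fun s hs =>
            ENNReal.ofReal_le_ofReal ?_) _
          have hs0 : 0 < s := by linarith [hs.1]
          refine le_trans ?_ (hg s ⟨hs0, by linarith [hs.2, ht.2]⟩).1
          gcongr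
          exact (rpow_mem_Icc_mul (-a - 1) (by norm_num) ht0 ⟨hs.1, by linarith [hs.2]⟩).1
      _ ≤ _ := by
          rw [← hwin _ _ (by positivity) (by linarith [ht.2])]
          gcongr
          linarith

/-! ### Densities with exponential decay -/

theorem integrableOn_rpow_mul_exp_neg_rpow_Ici {p δ : ℝ} (e : ℝ) (hp : 0 < p) (hδ : 0 < δ) :
    IntegrableOn (fun s : ℝ => s ^ e * Real.exp (-s ^ p)) (Ici δ) := by
  have hm : (-1 : ℝ) < max e 0 := by linarith [le_max_right e 0]
  have h := ((integrableOn_rpow_mul_exp_neg_rpow hm hp).mono_set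
    (Ici_subset_Ioi.2 hδ)).const_mul (δ ^ (e - max e 0))
  refine h.mono' (Measurable.aestronglyMeasurable (by fun_prop)) ?_
  refine (ae_restrict_mem measurableSet_Ici).mono fun s hs => ?_
  have hs0 : 0 < s := hδ.trans_le hs
  rw [Real.norm_of_nonneg (by positivity), ← mul_assoc]
  -- Away from the origin, lowering the exponent from max(e, 0) to e costs a factor of at most δ^{e
  -- - max(e, 0)}, so every real e is allowed.
  gcongr
  rw [show s ^ e = s ^ (e - max e 0) * s ^ max e 0 by rw [← Real.rpow_add hs0]; ring_nf]
  have hle := Real.rpow_le_rpow_of_nonpos hδ hs (sub_nonpos.2 (le_max_left e 0))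
  gcongr

theorem setLIntegral_rpow_psi_Ici_ne_top (α e : ℝ) {p δ : ℝ} (hp : 0 < p) (hδ : 0 < δ) :
    ∫⁻ s in Ici δ, ENNReal.ofReal (s ^ e) ∂(psi α p) ≠ ∞ := by
  refine setLIntegral_withDensity_ne_top measurableSet_Ici (by fun_prop) (by fun_prop)
    (fun s hs => Real.rpow_nonneg (le_of_lt hs.2) _) measurableSet_Ioi ?_
  refine ((integrableOn_rpow_mul_exp_neg_rpow_Ici (e + (-α - 1)) hp hδ).mono_set
    inter_subset_left).congr_fun (fun s hs => ?_) (measurableSet_Ici.inter measurableSet_Ioi)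
  simp only
  rw [Real.rpow_add hs.2, mul_assoc]

theorem setLIntegral_rpow_psi_Ioo_ne_top {α e p : ℝ} (hp : 0 < p) (he : α < e) :
    ∫⁻ s in Ioo (0 : ℝ) 1, ENNReal.ofReal (s ^ e) ∂(psi α p) ≠ ∞ := by
  refine setLIntegral_withDensity_ne_top measurableSet_Ioo (by fun_prop) (by fun_prop)
    (fun s hs => Real.rpow_nonneg (le_of_lt hs.2) _) measurableSet_Ioi ?_
  refine ((integrableOn_rpow_mul_exp_neg_rpow (s := e + (-α - 1)) (by linarith) hp).mono_set
    inter_subset_right).congr_fun (fun s hs => ?_) (measurableSet_Ioo.inter measurableSet_Ioi)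
  simp only
  rw [Real.rpow_add hs.2, mul_assoc]

theorem hasPowerOrder_psi (α : ℝ) {p : ℝ} (hp : 0 < p) : HasPowerOrder α (psi α p) := by
  refine hasPowerOrder_withDensity (c := Real.exp (-1)) (C := 1)
    (fun s hs => hs.1) (Real.exp_pos _) (fun s hs => ?_) ?_
  · have hs0 : 0 < s := hs.1
    have h1 : s ^ p ≤ 1 := Real.rpow_le_one hs0.le (by linarith [hs.2]) hp.le
    have h0 : 0 ≤ s ^ p := by positivity
    rw [mul_comm (s ^ (-α - 1))]
    constructor
    · gcongr
    · gcongr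
      simpa using h0
  · have := setLIntegral_rpow_psi_Ici_ne_top α 2 hp (δ := 1 / 4) (by norm_num)
    simp only [Real.rpow_two] at this
    exact this

/-! ### Densities of beta type on (0, 1) -/

theorem integrableOn_rpow_mul_one_sub_rpow {p δ E : ℝ} (e : ℝ) (hp : 0 < p) (hδ : 0 < δ)
    (hE : -1 < E) : IntegrableOn (fun s : ℝ => s ^ e * (1 - s ^ p) ^ E) (Icc δ 1) := by
  -- The singularity at s = 1 (for E < 0) is handled with the exponent p - 1, where the integrand is
  -- the nonnegative derivative of a function continuous up to 1. The remaining power of s is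
  -- continuous on [δ, 1].
  have h1 : IntegrableOn (fun s : ℝ => p * (E + 1) * (s ^ (p - 1) * (1 - s ^ p) ^ E)) (Ioc δ 1) := by
    refine intervalIntegral.integrableOn_deriv_of_nonneg
      (g := fun s : ℝ => -(1 - s ^ p) ^ (E + 1)) ?_ (fun s hs => ?_) (fun s hs => ?_)
    · exact (((continuous_const.sub (Real.continuous_rpow_const hp.le)).rpow_const
        fun _ => Or.inr (by linarith)).neg).continuousOn
    · have hs0 : 0 < s := hδ.trans hs.1
      have hlt : s ^ p < 1 := Real.rpow_lt_one hs0.le hs.2 hp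
      have := ((((Real.hasDerivAt_rpow_const (p := p) (Or.inl hs0.ne')).const_sub 1).rpow_const
        (p := E + 1) (Or.inl (by linarith))).neg)
      refine this.congr_deriv ?_
      rw [add_sub_cancel_right]
      ring
    · have hs0 : 0 < s := hδ.trans hs.1
      have hlt : s ^ p < 1 := Real.rpow_lt_one hs0.le hs.2 hp
      have : 0 < 1 - s ^ p := by linarith
      have : 0 < E + 1 := by linarith
      positivity
  rw [← integrableOn_Icc_iff_integrableOn_Ioc] at h1
  have hcont : ContinuousOn (fun s : ℝ => s ^ (e - p + 1) / (p * (E + 1))) (Icc δ 1) := by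
    refine ContinuousOn.div_const (fun s hs => ?_) _
    exact (Real.continuousAt_rpow_const _ _
      (Or.inl (hδ.trans_le hs.1).ne')).continuousWithinAt
  refine (h1.continuousOn_mul hcont isCompact_Icc).congr_fun (fun s hs => ?_) measurableSet_Icc
  have hs0 : 0 < s := hδ.trans_le hs.1
  have : E + 1 ≠ 0 := by linarith
  have he : s ^ e = s ^ (e - p + 1) * s ^ (p - 1) := by rw [← Real.rpow_add hs0]; ring_nf
  simp only
  rw [he]
  field_simp

theorem tauConst_pos {α β p : ℝ} (hβα : β < α) (hp : 0 < p) : 0 < tauConst α β p := by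
  rw [tauConst, integral_rpow_mul_exp_neg_rpow hp (by linarith)]
  have : 0 < α - β - 1 + 1 := by linarith
  have := Real.Gamma_pos_of_pos (div_pos this hp)
  positivity

theorem neg_one_lt_tau_exponent {α β p : ℝ} (hβα : β < α) (hp : 0 < p) :
    -1 < (α - β) / p - 1 := by
  have : 0 < (α - β) / p := div_pos (by linarith) hp
  linarith

theorem one_sub_rpow_mem_Icc {p : ℝ} (hp : 0 < p) {s : ℝ} (hs : s ∈ Ioo (0 : ℝ) (1 / 2)) (E : ℝ) :
    (1 - s ^ p) ^ E ∈ Icc ((1 - (1 / 2 : ℝ) ^ p)⁻¹ ^ (-|E|)) ((1 - (1 / 2 : ℝ) ^ p)⁻¹ ^ |E|) := by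
  have h0 : (1 / 2 : ℝ) ^ p < 1 := Real.rpow_lt_one (by norm_num) (by norm_num) hp
  have h1 : 0 < (1 / 2 : ℝ) ^ p := by positivity
  have h2 : s ^ p ≤ (1 / 2 : ℝ) ^ p := Real.rpow_le_rpow hs.1.le hs.2.le hp.le
  have h3 : 0 ≤ s ^ p := Real.rpow_nonneg hs.1.le _
  have h4 : 1 ≤ (1 - (1 / 2 : ℝ) ^ p)⁻¹ := (one_le_inv₀ (by linarith)).2 (by linarith)
  exact rpow_mem_Icc _ h4 ⟨by rw [inv_inv]; linarith, by linarith⟩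

theorem setLIntegral_rpow_tau_Ici_ne_top {α β p δ : ℝ} (e : ℝ) (hβα : β < α) (hp : 0 < p)
    (hδ : 0 < δ) : ∫⁻ s in Ici δ, ENNReal.ofReal (s ^ e) ∂(tau β α p) ≠ ∞ := by
  refine setLIntegral_withDensity_ne_top measurableSet_Ici (by fun_prop) (by fun_prop)
    (fun s hs => Real.rpow_nonneg (le_of_lt hs.2.1) _) measurableSet_Ioo ?_
  refine (IntegrableOn.mono_set (Integrable.const_mul (integrableOn_rpow_mul_one_sub_rpow (e + (-α - 1)) hp hδ
    (neg_one_lt_tau_exponent hβα hp)) (1 / tauConst α β p))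
    (fun s hs => ⟨hs.1, hs.2.2.le⟩)).congr_fun (fun s hs => ?_)
    (measurableSet_Ici.inter measurableSet_Ioo)
  simp only [Real.rpow_add hs.2.1]
  ring

theorem setLIntegral_rpow_tau_Ioo_ne_top {α β p e : ℝ} (hβα : β < α) (hp : 0 < p) (he : α < e) :
    ∫⁻ s in Ioo (0 : ℝ) 1, ENNReal.ofReal (s ^ e) ∂(tau β α p) ≠ ∞ := by
  -- The cut at 1/2 separates the two possible singularities: the power at 0, where α < e is needed,
  -- and the factor with 1 - s^p at 1.
  refine ne_top_of_le_ne_top (ENNReal.add_ne_top.2 ⟨?_, setLIntegral_rpow_tau_Ici_ne_top e hβα hp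
      (δ := 1 / 2) (by norm_num)⟩) ((lintegral_mono_set (t := Ioo 0 (1 / 2) ∪ Ici (1 / 2))
      fun s hs => (lt_or_ge s (1 / 2)).imp (fun h => ⟨hs.1, h⟩) id).trans
      (lintegral_union_le _ _ _))
  refine setLIntegral_withDensity_ne_top measurableSet_Ioo (by fun_prop) (by fun_prop)
    (fun s hs => Real.rpow_nonneg (le_of_lt hs.2.1) _) measurableSet_Ioo ?_
  rw [inter_eq_left.2 (Ioo_subset_Ioo_right (by norm_num))]
  have hint : IntegrableOn (fun s : ℝ => s ^ (e + (-α - 1))) (Ioo 0 (1 / 2)) :=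
    (intervalIntegral.integrableOn_Ioo_rpow_iff (by norm_num)).2 (by linarith)
  have hK := tauConst_pos hβα hp
  refine (hint.const_mul (1 / tauConst α β p *
    (1 - (1 / 2 : ℝ) ^ p)⁻¹ ^ |(α - β) / p - 1|)).mono'
    (Measurable.aestronglyMeasurable (by fun_prop)) ?_
  refine (ae_restrict_mem measurableSet_Ioo).mono fun s hs => ?_
  have hb := one_sub_rpow_mem_Icc hp hs ((α - β) / p - 1)
  have hs0 : 0 < s := hs.1
  have hp1 : s ^ p < 1 := Real.rpow_lt_one hs0.le (by linarith [hs.2]) hp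
  have hpos : 0 < (1 - s ^ p) ^ ((α - β) / p - 1) := Real.rpow_pos_of_pos (by linarith) _
  rw [Real.norm_of_nonneg (by positivity), Real.rpow_add hs0]
  calc _ = 1 / tauConst α β p * (1 - s ^ p) ^ ((α - β) / p - 1) * (s ^ e * s ^ (-α - 1)) := by ring
    _ ≤ _ := by
      gcongr
      exact hb.2

theorem setLIntegral_tau_Ici_one (β α p : ℝ) (f : ℝ → ℝ≥0∞) :
    ∫⁻ s in Ici (1 : ℝ), f s ∂(tau β α p) = 0 := by
  have : (tau β α p) (Ici 1) = 0 := by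
    rw [tau, withDensity_apply _ measurableSet_Ici, Measure.restrict_restrict measurableSet_Ici,
      show Ici (1 : ℝ) ∩ Ioo 0 1 = ∅ from eq_empty_of_forall_notMem fun s hs =>
        absurd hs.2.2 (not_lt.2 hs.1)]
    simp
  exact setLIntegral_measure_zero _ _ this

theorem hasPowerOrder_tau {α β p : ℝ} (hβα : β < α) (hp : 0 < p) :
    HasPowerOrder α (tau β α p) := by
  have hK := tauConst_pos hβα hp
  have h0 : (1 / 2 : ℝ) ^ p < 1 := Real.rpow_lt_one (by norm_num) (by norm_num) hp
  have hA : 0 < (1 - (1 / 2 : ℝ) ^ p)⁻¹ := inv_pos.2 (by linarith)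
  refine hasPowerOrder_withDensity
    (c := 1 / tauConst α β p * (1 - (1 / 2 : ℝ) ^ p)⁻¹ ^ (-|(α - β) / p - 1|))
    (C := 1 / tauConst α β p * (1 - (1 / 2 : ℝ) ^ p)⁻¹ ^ |(α - β) / p - 1|)
    (Ioo_subset_Ioo_right (by norm_num)) (by positivity) (fun s hs => ?_) ?_
  · have hb := one_sub_rpow_mem_Icc hp hs ((α - β) / p - 1)
    have hs0 : 0 < s := hs.1
    rw [mul_right_comm _ (s ^ (-α - 1))]
    constructor
    · gcongr
      exact hb.1
    · gcongr
      exact hb.2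
  · have := setLIntegral_rpow_tau_Ici_ne_top 2 hβα hp (δ := 1 / 4) (by norm_num)
    simp only [Real.rpow_two] at this
    exact this

/-! ### Tails and moments of the one-sided stable distributions -/

/-- The one-sided `κ`-stable distribution with Laplace transform `exp (-t ^ κ)`. -/
noncomputable def stableMeasure (κ : ℝ) : Measure ℝ :=
  (volume.restrict (Ioi 0)).withDensity fun x => ENNReal.ofReal (stableDensity κ x)

theorem ae_pos_stableMeasure (κ : ℝ) : ∀ᵐ x ∂(stableMeasure κ), 0 < x :=
  (withDensity_absolutelyContinuous _ _).ae_le (ae_restrict_mem measurableSet_Ioi)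

theorem lintegral_exp_stableMeasure {κ t : ℝ} (h0 : 0 < κ) (h1 : κ < 1) (ht : 0 ≤ t) :
    ∫⁻ x, ENNReal.ofReal (Real.exp (-(t * x))) ∂(stableMeasure κ)
      = ENNReal.ofReal (Real.exp (-t ^ κ)) := by
  have hf := stableDensity_spec h0 h1
  have hL := hf.laplace t ht
  -- A non-integrable function has Bochner integral 0 by convention, so the nonzero value of the
  -- integral forces integrability.
  have hi : IntegrableOn (fun x => Real.exp (-(t * x)) * stableDensity κ x) (Ioi 0) :=
    not_imp_comm.1 integral_undef (by rw [hL]; exact (Real.exp_pos _).ne')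
  rw [stableMeasure, lintegral_withDensity_eq_lintegral_mul _ hf.measurable.ennreal_ofReal
    (by fun_prop), ← hL, ofReal_integral_eq_lintegral_ofReal hi
      (Eventually.of_forall fun x => mul_nonneg (Real.exp_pos _).le (hf.nonneg x))]
  refine lintegral_congr fun x => ?_
  rw [Pi.mul_apply, mul_comm, ENNReal.ofReal_mul (Real.exp_pos _).le]

theorem isProbabilityMeasure_stableMeasure {κ : ℝ} (h0 : 0 < κ) (h1 : κ < 1) :
    IsProbabilityMeasure (stableMeasure κ) := ⟨by
  simpa [Real.zero_rpow h0.ne'] using lintegral_exp_stableMeasure h0 h1 le_rfl⟩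

theorem integral_exp_stableMeasure {κ t : ℝ} (h0 : 0 < κ) (h1 : κ < 1) (ht : 0 ≤ t) :
    ∫ x, Real.exp (-(t * x)) ∂(stableMeasure κ) = Real.exp (-t ^ κ) := by
  rw [integral_eq_lintegral_of_nonneg_ae (Eventually.of_forall fun _ => (Real.exp_pos _).le)
    (by fun_prop), lintegral_exp_stableMeasure h0 h1 ht, ENNReal.toReal_ofReal (Real.exp_pos _).le]

theorem integrable_exp_stableMeasure {κ t : ℝ} (h0 : 0 < κ) (h1 : κ < 1) (ht : 0 ≤ t) :
    Integrable (fun x => Real.exp (-(t * x))) (stableMeasure κ) :=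
  not_imp_comm.1 integral_undef
    (by rw [integral_exp_stableMeasure h0 h1 ht]; exact (Real.exp_pos _).ne')

theorem integral_one_sub_exp_stableMeasure {κ t : ℝ} (h0 : 0 < κ) (h1 : κ < 1) (ht : 0 ≤ t) :
    ∫ x, (1 - Real.exp (-(t * x))) ∂(stableMeasure κ) = 1 - Real.exp (-t ^ κ) := by
  have := isProbabilityMeasure_stableMeasure h0 h1
  rw [integral_sub (integrable_const _) (integrable_exp_stableMeasure h0 h1 ht),
    integral_exp_stableMeasure h0 h1 ht]
  simp

theorem one_sub_exp_neg_le (v : ℝ) : 1 - Real.exp (-v) ≤ v := by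
  linarith [Real.add_one_le_exp (-v)]

theorem exp_neg_one_le_half : Real.exp (-1) ≤ 1 / 2 := by
  rw [Real.exp_neg, one_div]
  exact inv_anti₀ two_pos (by linarith [Real.add_one_le_exp (1 : ℝ)])

theorem half_le_one_sub_exp_neg {v : ℝ} (h0 : 0 ≤ v) (h1 : v ≤ 1) : v / 2 ≤ 1 - Real.exp (-v) := by
  have h : Real.exp (-v) * (1 + v) ≤ 1 := by
    calc Real.exp (-v) * (1 + v) ≤ Real.exp (-v) * Real.exp v := by
          gcongr; linarith [Real.add_one_le_exp v]
      _ = 1 := by rw [← Real.exp_add]; simp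
  have h2 : Real.exp (-v) ≤ 1 / (1 + v) := by rwa [le_div_iff₀ (by linarith)]
  have h3 : 1 / (1 + v) ≤ 1 - v / 2 := by
    rw [div_le_iff₀ (by linarith)]; nlinarith
  linarith

theorem one_le_two_mul_one_sub_exp {v : ℝ} (h : 1 ≤ v) : 1 ≤ 2 * (1 - Real.exp (-v)) := by
  have : Real.exp (-v) ≤ Real.exp (-1) := Real.exp_le_exp.2 (by linarith)
  linarith [exp_neg_one_le_half]

/-- Markov-type bound: for y > 0 the indicator of y ≥ x is at most 2(1 - e^{-y/x}), whose mean is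
2(1 - exp(-x^{-κ})). -/
theorem stableMeasure_Ici_le {κ x : ℝ} (h0 : 0 < κ) (h1 : κ < 1) (hx : 0 < x) :
    stableMeasure κ (Ici x) ≤ ENNReal.ofReal (2 * x ^ (-κ)) := by
  have := isProbabilityMeasure_stableMeasure h0 h1
  have hi : 0 ≤ x⁻¹ := inv_nonneg.2 hx.le
  rw [← ofReal_measureReal (measure_ne_top _ _)]
  refine ENNReal.ofReal_le_ofReal ?_
  calc (stableMeasure κ).real (Ici x)
      = ∫ y, (Ici x).indicator 1 y ∂(stableMeasure κ) := (integral_indicator_one measurableSet_Ici).symm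
    _ ≤ ∫ y, 2 * (1 - Real.exp (-(x⁻¹ * y))) ∂(stableMeasure κ) := by
        refine integral_mono_ae ((integrable_const 1).indicator measurableSet_Ici)
          (((integrable_const 1).sub (integrable_exp_stableMeasure h0 h1 hi)).const_mul 2) ?_
        filter_upwards [ae_pos_stableMeasure κ] with y hy
        by_cases hxy : x ≤ y
        · rw [indicator_of_mem (mem_Ici.2 hxy)]
          refine one_le_two_mul_one_sub_exp ?_
          rwa [inv_mul_eq_div, one_le_div hx]
        · rw [indicator_of_notMem (by simpa using hxy)]
          have : Real.exp (-(x⁻¹ * y)) ≤ 1 := Real.exp_le_one_iff.2 (by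
            have : 0 ≤ x⁻¹ * y := by positivity
            linarith)
          linarith
    _ = 2 * (1 - Real.exp (-x⁻¹ ^ κ)) := by
        rw [integral_const_mul, integral_one_sub_exp_stableMeasure h0 h1 hi]
    _ ≤ 2 * x ^ (-κ) := by
        rw [Real.rpow_neg hx.le, ← Real.inv_rpow hx.le]
        gcongr
        exact one_sub_exp_neg_le _

/-- The three terms cover y ≤ x, x < y ≤ Bx and y > Bx. The outer two are built from exponentials,
so their stable means are explicit, and integrating isolates the mass of the window. -/
theorem one_sub_exp_le_window {t x y B : ℝ} (ht : 0 < t) (hx : 0 < x) (hy : 0 < y) (hB : 1 ≤ B) :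
    1 - Real.exp (-(t * y)) ≤
      2 * Real.exp 1 * t * x * (Real.exp (-((2 * x)⁻¹ * y)) - Real.exp (-(x⁻¹ * y)))
        + (Ioc x (B * x)).indicator 1 y + 2 * (1 - Real.exp (-((B * x)⁻¹ * y))) := by
  have hB0 : 0 < B := by linarith
  set v := (2 * x)⁻¹ * y with hv
  have hv0 : 0 < v := by positivity
  have hyv : y = 2 * x * v := by rw [hv]; field_simp
  have hxy : x⁻¹ * y = v + v := by rw [hyv]; field_simp; ring
  -- From e^v ≥ 1 + v. For y ≤ x one has 2v ≤ 1, so the difference of exponentials dominates a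
  -- multiple of y and stands in for a truncated first moment.
  have hT1 : v * Real.exp (-(v + v)) ≤ Real.exp (-v) - Real.exp (-(v + v)) := by
    have e : Real.exp (-v) = Real.exp (-(v + v)) * Real.exp v := by rw [← Real.exp_add]; ring_nf
    have h := mul_le_mul_of_nonneg_left (Real.add_one_le_exp v) (Real.exp_pos (-(v + v))).le
    linarith
  rw [hxy]
  have hT1' : 0 ≤ Real.exp (-v) - Real.exp (-(v + v)) := le_trans (by positivity) hT1
  have hP1 : 0 ≤ 2 * Real.exp 1 * t * x * (Real.exp (-v) - Real.exp (-(v + v))) := by positivity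
  have hP2 : 0 ≤ (Ioc x (B * x)).indicator (1 : ℝ → ℝ) y :=
    indicator_nonneg (fun _ _ => zero_le_one) y
  have hP3 : 0 ≤ 2 * (1 - Real.exp (-((B * x)⁻¹ * y))) := by
    have : Real.exp (-((B * x)⁻¹ * y)) ≤ 1 := Real.exp_le_one_iff.2 (by
      have : 0 ≤ (B * x)⁻¹ * y := by positivity
      linarith)
    linarith
  have hle1 : 1 - Real.exp (-(t * y)) ≤ 1 := by linarith [Real.exp_pos (-(t * y))]
  rcases le_or_gt y x with h | h
  · have hvv : v + v ≤ 1 := by rw [← hxy, inv_mul_eq_div, div_le_one hx]; exact h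
    have h1 : 1 ≤ Real.exp 1 * Real.exp (-(v + v)) := by
      rw [← Real.exp_add]; exact Real.one_le_exp (by linarith)
    have : t * y ≤ 2 * Real.exp 1 * t * x * (Real.exp (-v) - Real.exp (-(v + v))) := by
      calc t * y = t * y * 1 := (mul_one _).symm
        _ ≤ t * y * (Real.exp 1 * Real.exp (-(v + v))) := by gcongr
        _ = 2 * Real.exp 1 * t * x * (v * Real.exp (-(v + v))) := by rw [hyv]; ring
        _ ≤ _ := by gcongr
    linarith [one_sub_exp_neg_le (t * y)]
  · rcases le_or_gt y (B * x) with h' | h'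
    · have : (Ioc x (B * x)).indicator (1 : ℝ → ℝ) y = 1 :=
        indicator_of_mem (mem_Ioc.2 ⟨h, h'⟩) _
      linarith
    · have : 1 ≤ 2 * (1 - Real.exp (-((B * x)⁻¹ * y))) := by
        refine one_le_two_mul_one_sub_exp ?_
        rw [inv_mul_eq_div, one_le_div (by positivity)]
        exact h'.le
      linarith

/-- Integrate `one_sub_exp_le_window` at t = η/x. The left side is at least η^κ x^{-κ}/2, while the
parts below x and above Bx each take at most η^κ x^{-κ}/8, so the window keeps at least η^κ
x^{-κ}/4. -/
theorem le_stableMeasure_Ioc {κ : ℝ} (h0 : 0 < κ) (h1 : κ < 1) : ∃ B : ℝ, 1 ≤ B ∧ ∃ c : ℝ, 0 < c ∧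
    ∀ x, 1 ≤ x → ENNReal.ofReal (c * x ^ (-κ)) ≤ stableMeasure κ (Ioc x (B * x)) := by
  have := isProbabilityMeasure_stableMeasure h0 h1
  have hE : (1 : ℝ) ≤ 16 * Real.exp 1 := by linarith [Real.add_one_le_exp (1 : ℝ)]
  have hE0 : 0 < 16 * Real.exp 1 := by positivity
  have hκ : 0 < 1 - κ := by linarith
  -- Chosen so that 2eη = η^κ/8. Such a small η exists because κ < 1 makes η negligible against η^κ.
  set η : ℝ := (16 * Real.exp 1) ^ (-(1 / (1 - κ))) with hη
  have hη0 : 0 < η := by positivity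
  have hη1 : η ≤ 1 := Real.rpow_le_one_of_one_le_of_nonpos hE (by
    have : 0 < 1 / (1 - κ) := by positivity
    linarith)
  have hηκ : 2 * Real.exp 1 * η = η ^ κ / 8 := by
    have e1 : η ^ (1 - κ) = (16 * Real.exp 1)⁻¹ := by
      rw [hη, ← Real.rpow_mul hE0.le, ← Real.rpow_neg_one]
      congr 1
      field_simp
    have e2 : η = η ^ κ * η ^ (1 - κ) := by
      rw [← Real.rpow_add hη0]; simp
    calc 2 * Real.exp 1 * η = 2 * Real.exp 1 * (η ^ κ * η ^ (1 - κ)) := by rw [← e2]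
      _ = _ := by rw [e1]; field_simp; norm_num
  -- Chosen so that 2B^{-κ} = η^κ/8.
  set B : ℝ := 16 ^ (1 / κ) * η⁻¹ with hBdef
  have h16 : (1 : ℝ) ≤ 16 ^ (1 / κ) := Real.one_le_rpow (by norm_num) (by positivity)
  have hB : 1 ≤ B := one_le_mul_of_one_le_of_one_le h16 ((one_le_inv₀ hη0).2 hη1)
  have hB0 : 0 < B := by linarith
  have hBκ : B⁻¹ ^ κ = η ^ κ / 16 := by
    rw [hBdef, mul_inv, inv_inv, Real.mul_rpow (by positivity) hη0.le, Real.inv_rpow (by positivity),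
      ← Real.rpow_mul (by norm_num)]
    rw [one_div_mul_cancel h0.ne', Real.rpow_one]
    ring
  refine ⟨B, hB, η ^ κ / 4, by positivity, fun x hx => ?_⟩
  have hx0 : 0 < x := by linarith
  have hi1 : 0 ≤ (2 * x)⁻¹ := by positivity
  have hi2 : 0 ≤ x⁻¹ := by positivity
  have hi3 : 0 ≤ (B * x)⁻¹ := by positivity
  have ht : 0 < η * x⁻¹ := by positivity
  have hI1 : Integrable (fun y => 2 * Real.exp 1 * (η * x⁻¹) * x *
      (Real.exp (-((2 * x)⁻¹ * y)) - Real.exp (-(x⁻¹ * y)))) (stableMeasure κ) :=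
    ((integrable_exp_stableMeasure h0 h1 hi1).sub
      (integrable_exp_stableMeasure h0 h1 hi2)).const_mul _
  have hI2 : Integrable ((Ioc x (B * x)).indicator (1 : ℝ → ℝ)) (stableMeasure κ) :=
    (integrable_const 1).indicator measurableSet_Ioc
  have hI3 : Integrable (fun y => 2 * (1 - Real.exp (-((B * x)⁻¹ * y)))) (stableMeasure κ) :=
    ((integrable_const 1).sub (integrable_exp_stableMeasure h0 h1 hi3)).const_mul 2
  have hmain : ∫ y, (1 - Real.exp (-(η * x⁻¹ * y))) ∂(stableMeasure κ) ≤
      ∫ y, (2 * Real.exp 1 * (η * x⁻¹) * x *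
        (Real.exp (-((2 * x)⁻¹ * y)) - Real.exp (-(x⁻¹ * y)))
        + (Ioc x (B * x)).indicator 1 y + 2 * (1 - Real.exp (-((B * x)⁻¹ * y)))) ∂(stableMeasure κ) :=
    integral_mono_ae
    ((integrable_const 1).sub (integrable_exp_stableMeasure h0 h1 ht.le))
    ((hI1.add hI2).add hI3)
    ((ae_pos_stableMeasure κ).mono fun y hy => one_sub_exp_le_window ht hx0 hy hB)
  rw [integral_add (f := fun y => 2 * Real.exp 1 * (η * x⁻¹) * x *
      (Real.exp (-((2 * x)⁻¹ * y)) - Real.exp (-(x⁻¹ * y))) + (Ioc x (B * x)).indicator 1 y)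
      (hI1.add hI2) hI3, integral_add hI1 hI2, integral_one_sub_exp_stableMeasure h0 h1 ht.le,
    integral_const_mul, integral_const_mul, integral_one_sub_exp_stableMeasure h0 h1 hi3,
    integral_indicator_one measurableSet_Ioc,
    integral_sub (integrable_exp_stableMeasure h0 h1 hi1) (integrable_exp_stableMeasure h0 h1 hi2),
    integral_exp_stableMeasure h0 h1 hi1, integral_exp_stableMeasure h0 h1 hi2] at hmain
  have hlow : (η * x⁻¹) ^ κ / 2 ≤ 1 - Real.exp (-(η * x⁻¹) ^ κ) :=
    half_le_one_sub_exp_neg (by positivity) (Real.rpow_le_one ht.le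
      (mul_le_one₀ hη1 hi2 (inv_le_one_of_one_le₀ hx)) h0.le)
  have hb1 : Real.exp (-(2 * x)⁻¹ ^ κ) - Real.exp (-x⁻¹ ^ κ) ≤ x⁻¹ ^ κ := by
    have : Real.exp (-(2 * x)⁻¹ ^ κ) ≤ 1 := Real.exp_le_one_iff.2 (by
      have : 0 ≤ (2 * x)⁻¹ ^ κ := by positivity
      linarith)
    linarith [one_sub_exp_neg_le (x⁻¹ ^ κ)]
  have hb1' : 2 * Real.exp 1 * (η * x⁻¹) * x *
      (Real.exp (-(2 * x)⁻¹ ^ κ) - Real.exp (-x⁻¹ ^ κ)) ≤ η ^ κ / 8 * x⁻¹ ^ κ := by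
    rw [← hηκ]
    calc _ ≤ 2 * Real.exp 1 * (η * x⁻¹) * x * x⁻¹ ^ κ := by gcongr
      _ = _ := by field_simp
  have hb3 : 2 * (1 - Real.exp (-(B * x)⁻¹ ^ κ)) ≤ η ^ κ / 8 * x⁻¹ ^ κ := by
    have h := one_sub_exp_neg_le ((B * x)⁻¹ ^ κ)
    rw [mul_inv, Real.mul_rpow (by positivity) hi2, hBκ] at h
    rw [mul_inv, Real.mul_rpow (by positivity) hi2, hBκ]
    linarith
  rw [Real.mul_rpow hη0.le hi2] at hlow hmain
  rw [← ofReal_measureReal (measure_ne_top _ _), Real.rpow_neg hx0.le, ← Real.inv_rpow hx0.le]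
  refine ENNReal.ofReal_le_ofReal ?_
  linarith

/-! ### Moments of the stable distributions -/

theorem lintegral_one_sub_exp_stableMeasure_le {κ t : ℝ} (h0 : 0 < κ) (h1 : κ < 1) (ht : 0 ≤ t) :
    ∫⁻ x, ENNReal.ofReal (1 - Real.exp (-(t * x))) ∂(stableMeasure κ) ≤ ENNReal.ofReal (t ^ κ) := by
  have := isProbabilityMeasure_stableMeasure h0 h1
  rw [← ofReal_integral_eq_lintegral_ofReal (f := fun x => 1 - Real.exp (-(t * x)))
    ((integrable_const 1).sub (integrable_exp_stableMeasure h0 h1 ht)),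
    integral_one_sub_exp_stableMeasure h0 h1 ht]
  · exact ENNReal.ofReal_le_ofReal (one_sub_exp_neg_le _)
  · filter_upwards [ae_pos_stableMeasure κ] with x hx
    have : 0 ≤ t * x := by positivity
    have : Real.exp (-(t * x)) ≤ 1 := Real.exp_le_one_iff.2 (by linarith)
    simp only [Pi.zero_apply]
    linarith

/-- For x > 1, x^m is at most a constant times ∫_0^1 t^{-m-1}(1 - e^{-tx}) dt, already from t in
(1/(2x), 1/x). By Tonelli and 1 - exp(-t^κ) ≤ t^κ, what remains is ∫_0^1 t^{κ-m-1} dt, finite for m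
< κ. -/
theorem setLIntegral_rpow_stableMeasure_Ioi_ne_top {κ m : ℝ} (h0 : 0 < κ) (h1 : κ < 1)
    (hm : m < κ) : ∫⁻ x in Ioi (1 : ℝ), ENNReal.ofReal (x ^ m) ∂(stableMeasure κ) ≠ ∞ := by
  have := isProbabilityMeasure_stableMeasure h0 h1
  set c : ℝ := 2 ^ (-|-m - 1|) / 8 with hc
  have hc0 : 0 < c := by positivity
  have hpt : ∀ x ∈ Ioi (1 : ℝ), ENNReal.ofReal (c * x ^ m) ≤
      ∫⁻ t in Ioo (0 : ℝ) 1, ENNReal.ofReal (t ^ (-m - 1)) * ENNReal.ofReal (1 - Real.exp (-(t * x))) := by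
    intro x hx
    have hx1 : 1 < x := hx
    have hx0 : 0 < x := by linarith
    calc ENNReal.ofReal (c * x ^ m)
        = ∫⁻ t in Ioo (x⁻¹ / 2) x⁻¹,
            ENNReal.ofReal (2 ^ (-|-m - 1|) * x⁻¹ ^ (-m - 1)) * ENNReal.ofReal (1 / 4) := by
          rw [setLIntegral_const, Real.volume_Ioo, ← ENNReal.ofReal_mul (by positivity),
            ← ENNReal.ofReal_mul (by positivity), Real.inv_rpow hx0.le,
            ← Real.rpow_neg hx0.le, show -(-m - 1) = m + 1 by ring, Real.rpow_add_one hx0.ne', hc]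
          congr 1
          field_simp
          norm_num
      _ ≤ ∫⁻ t in Ioo (x⁻¹ / 2) x⁻¹,
            ENNReal.ofReal (t ^ (-m - 1)) * ENNReal.ofReal (1 - Real.exp (-(t * x))) := by
          refine setLIntegral_mono' measurableSet_Ioo fun t ht => ?_
          have hi : 0 < x⁻¹ := inv_pos.2 hx0
          have hlow : 1 / 2 ≤ t * x := by
            have := mul_le_mul_of_nonneg_right ht.1.le hx0.le
            rwa [div_mul_eq_mul_div, inv_mul_cancel₀ hx0.ne'] at this
          have hup : t * x ≤ 1 := by
            have := mul_le_mul_of_nonneg_right ht.2.le hx0.le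
            rwa [inv_mul_cancel₀ hx0.ne'] at this
          refine mul_le_mul' (ENNReal.ofReal_le_ofReal ?_) (ENNReal.ofReal_le_ofReal ?_)
          · exact (rpow_mem_Icc_mul (-m - 1) one_le_two hi ⟨ht.1.le, by linarith [ht.2]⟩).1
          · linarith [half_le_one_sub_exp_neg (by linarith) hup]
      _ ≤ _ := by
          have : x⁻¹ < 1 := inv_lt_one_of_one_lt₀ hx1
          have : 0 < x⁻¹ := inv_pos.2 hx0
          exact lintegral_mono_set (Ioo_subset_Ioo (by linarith) (by linarith))
  have hfin : ENNReal.ofReal c * ∫⁻ x in Ioi (1 : ℝ), ENNReal.ofReal (x ^ m) ∂(stableMeasure κ)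
      < ∞ := by
    calc ENNReal.ofReal c * ∫⁻ x in Ioi (1 : ℝ), ENNReal.ofReal (x ^ m) ∂(stableMeasure κ)
        = ∫⁻ x in Ioi (1 : ℝ), ENNReal.ofReal (c * x ^ m) ∂(stableMeasure κ) := by
          rw [← lintegral_const_mul _ (by fun_prop)]
          exact lintegral_congr fun x => (ENNReal.ofReal_mul hc0.le).symm
      _ ≤ ∫⁻ x in Ioi (1 : ℝ), (∫⁻ t in Ioo (0 : ℝ) 1, ENNReal.ofReal (t ^ (-m - 1)) *
            ENNReal.ofReal (1 - Real.exp (-(t * x)))) ∂(stableMeasure κ) :=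
          setLIntegral_mono' measurableSet_Ioi hpt
      _ ≤ ∫⁻ x, (∫⁻ t in Ioo (0 : ℝ) 1, ENNReal.ofReal (t ^ (-m - 1)) *
            ENNReal.ofReal (1 - Real.exp (-(t * x)))) ∂(stableMeasure κ) :=
          setLIntegral_le_lintegral _ _
      _ = ∫⁻ t in Ioo (0 : ℝ) 1, (∫⁻ x, ENNReal.ofReal (t ^ (-m - 1)) *
            ENNReal.ofReal (1 - Real.exp (-(t * x))) ∂(stableMeasure κ)) :=
          lintegral_lintegral_swap (Measurable.aemeasurable (by fun_prop))
      _ ≤ ∫⁻ t in Ioo (0 : ℝ) 1, ENNReal.ofReal (t ^ (κ - m - 1)) := by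
          refine setLIntegral_mono' measurableSet_Ioo fun t ht => ?_
          rw [lintegral_const_mul _ (by fun_prop), show κ - m - 1 = (-m - 1) + κ by ring,
            Real.rpow_add ht.1, ENNReal.ofReal_mul (Real.rpow_nonneg ht.1.le _)]
          gcongr
          exact lintegral_one_sub_exp_stableMeasure_le h0 h1 ht.1.le
      _ < ∞ := ((intervalIntegral.integrableOn_Ioo_rpow_iff one_pos).2
          (by linarith)).lintegral_lt_top
  exact fun h => (ENNReal.mul_lt_top_iff.1 hfin).elim (fun h' => h'.2.ne h)
    (fun h' => h'.elim (fun h'' => (ENNReal.ofReal_pos.2 hc0).ne' h'') (fun h'' => by simp [h] at h''))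

/-- Write Γ(m) x^{-m} as ∫ t^{m-1} e^{-xt} dt. Tonelli turns the moment into ∫ t^{m-1} exp(-t^κ) dt.
-/
theorem lintegral_rpow_neg_stableMeasure_ne_top {κ m : ℝ} (h0 : 0 < κ) (h1 : κ < 1) (hm : 0 < m) :
    ∫⁻ x, ENNReal.ofReal (x ^ (-m)) ∂(stableMeasure κ) ≠ ∞ := by
  have := isProbabilityMeasure_stableMeasure h0 h1
  have hΓ := Real.Gamma_pos_of_pos hm
  have hfin : ENNReal.ofReal (Real.Gamma m) * ∫⁻ x, ENNReal.ofReal (x ^ (-m)) ∂(stableMeasure κ)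
      < ∞ := by
    calc ENNReal.ofReal (Real.Gamma m) * ∫⁻ x, ENNReal.ofReal (x ^ (-m)) ∂(stableMeasure κ)
        = ∫⁻ x, (∫⁻ t in Ioi (0 : ℝ), ENNReal.ofReal (t ^ (-(1 - m)) * Real.exp (-(x * t))))
            ∂(stableMeasure κ) := by
          rw [← lintegral_const_mul _ (by fun_prop)]
          refine lintegral_congr_ae ?_
          filter_upwards [ae_pos_stableMeasure κ] with x hx
          rw [lintegral_gamma (by linarith) hx, ENNReal.ofReal_mul (by ring_nf; exact hΓ.le)]
          ring_nf
      _ = ∫⁻ t in Ioi (0 : ℝ), (∫⁻ x, ENNReal.ofReal (t ^ (-(1 - m)) * Real.exp (-(x * t)))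
            ∂(stableMeasure κ)) :=
          lintegral_lintegral_swap (Measurable.aemeasurable (by fun_prop))
      _ = ∫⁻ t in Ioi (0 : ℝ), ENNReal.ofReal (t ^ (m - 1) * Real.exp (-t ^ κ)) := by
          refine setLIntegral_congr_fun measurableSet_Ioi fun t ht => ?_
          have ht0 : (0 : ℝ) < t := ht
          have hp : 0 ≤ t ^ (m - 1) := by positivity
          simp only [neg_sub, ENNReal.ofReal_mul hp]
          rw [lintegral_const_mul _ (by fun_prop), ← lintegral_exp_stableMeasure h0 h1 ht0.le]
          simp only [mul_comm]
      _ < ∞ := (integrableOn_rpow_mul_exp_neg_rpow (by linarith) h0).lintegral_lt_top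
  exact fun h => (ENNReal.mul_lt_top_iff.1 hfin).elim (fun h' => h'.2.ne h)
    (fun h' => h'.elim (fun h'' => (ENNReal.ofReal_pos.2 hΓ).ne' h'') (fun h'' => by simp [h] at h''))

theorem setLIntegral_rpow_stableMeasure_Ioc_ne_top {κ b : ℝ} (e : ℝ) (h0 : 0 < κ) (h1 : κ < 1)
    (hb : 0 < b) : ∫⁻ x in Ioc 0 b, ENNReal.ofReal (x ^ e) ∂(stableMeasure κ) ≠ ∞ := by
  -- Any m > 0 with e + m ≥ 0 would do: x^e = x^{e+m} x^{-m}, with the first factor bounded on (0,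
  -- b].
  have hm : 0 < max (-e) 0 + 1 := by linarith [le_max_right (-e) 0]
  have hem : 0 ≤ e + (max (-e) 0 + 1) := by linarith [le_max_left (-e) 0]
  refine ne_top_of_le_ne_top (ENNReal.mul_ne_top (ENNReal.ofReal_ne_top
    (r := b ^ (e + (max (-e) 0 + 1)))) (lintegral_rpow_neg_stableMeasure_ne_top h0 h1 hm)) ?_
  rw [← lintegral_const_mul _ (by fun_prop)]
  refine le_trans (setLIntegral_mono' measurableSet_Ioc fun x hx => ?_)
    (setLIntegral_le_lintegral _ _)
  have hx0 : 0 < x := hx.1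
  rw [← ENNReal.ofReal_mul (by positivity)]
  refine ENNReal.ofReal_le_ofReal ?_
  calc x ^ e = x ^ (e + (max (-e) 0 + 1)) * x ^ (-(max (-e) 0 + 1)) := by
        rw [← Real.rpow_add hx0]; ring_nf
    _ ≤ _ := by
        gcongr
        exact hx.2

/-! ### The dilation measures with stable densities -/

/-- The substitution x = s^{-p}: if X is q/p-stable, then π is the law of X^{-1/p} weighted by
X^{α/p}. Small s corresponds to the tail of X, large s to X near 0. -/
theorem lintegral_piMeasure (α : ℝ) {p q : ℝ} (hq : 0 < q) (hqp : q < p) {φ : ℝ → ℝ≥0∞}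
    (hφ : Measurable φ) : ∫⁻ s, φ s ∂(piMeasure α p q) =
      ∫⁻ x, ENNReal.ofReal (x ^ (α / p)) * φ (x ^ (-(1 / p))) ∂(stableMeasure (q / p)) := by
  have hp : 0 < p := hq.trans hqp
  have hf := stableDensity_spec (div_pos hq hp) ((div_lt_one hp).2 hqp)
  have hfm := hf.measurable
  have himg : (fun s : ℝ => s ^ (-p)) '' Ioi 0 = Ioi 0 := by
    ext x
    constructor
    · rintro ⟨s, hs, rfl⟩
      exact Real.rpow_pos_of_pos hs _
    · intro hx
      refine ⟨x ^ (-(1 / p)), Real.rpow_pos_of_pos hx _, ?_⟩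
      simp only
      rw [← Real.rpow_mul (le_of_lt hx), show -(1 / p) * -p = 1 by field_simp, Real.rpow_one]
  have hback : ∀ s : ℝ, 0 < s → (s ^ (-p)) ^ (-(1 / p)) = s := fun s hs => by
    rw [← Real.rpow_mul hs.le, show -p * -(1 / p) = 1 by field_simp, Real.rpow_one]
  have hinj : InjOn (fun s : ℝ => s ^ (-p)) (Ioi 0) := fun s hs t ht h => by
    rw [← hback s hs, ← hback t ht]
    exact congrArg (fun x : ℝ => x ^ (-(1 / p))) h
  rw [piMeasure, lintegral_withDensity_eq_lintegral_mul _ (by fun_prop) hφ, stableMeasure,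
    lintegral_withDensity_eq_lintegral_mul _ (by fun_prop) (by fun_prop)]
  have h := lintegral_image_eq_lintegral_abs_deriv_mul measurableSet_Ioi
    (fun x hx => (Real.hasDerivAt_rpow_const (p := -p)
      (Or.inl (ne_of_gt (mem_Ioi.1 hx)))).hasDerivWithinAt) hinj
    ((fun x => ENNReal.ofReal (stableDensity (q / p) x)) *
      fun x => ENNReal.ofReal (x ^ (α / p)) * φ (x ^ (-(1 / p))))
  rw [himg] at h
  rw [h]
  refine setLIntegral_congr_fun measurableSet_Ioi fun s hs => ?_
  have hs0 : (0 : ℝ) < s := hs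
  simp only [Pi.mul_apply]
  rw [hback s hs0, abs_mul, abs_neg, abs_of_pos hp, abs_of_pos (Real.rpow_pos_of_pos hs0 _),
    ← Real.rpow_mul hs0.le, show -p * (α / p) = -α by field_simp, ← mul_assoc, ← mul_assoc,
    ← ENNReal.ofReal_mul (by positivity),
    ← ENNReal.ofReal_mul (mul_nonneg (by positivity) (hf.nonneg _))]
  congr 2
  rw [show -α - p - 1 = (-p - 1) + -α by ring, Real.rpow_add hs0]
  ring

theorem setLIntegral_piMeasure_le (α : ℝ) {p q : ℝ} (hq : 0 < q) (hqp : q < p) {S T : Set ℝ}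
    (hS : MeasurableSet S) (hT : MeasurableSet T) (hST : ∀ x, 0 < x → x ^ (-(1 / p)) ∈ S → x ∈ T)
    (e : ℝ) : ∫⁻ s in S, ENNReal.ofReal (s ^ e) ∂(piMeasure α p q) ≤
      ∫⁻ x in T, ENNReal.ofReal (x ^ ((α - e) / p)) ∂(stableMeasure (q / p)) := by
  have hp : 0 < p := hq.trans hqp
  rw [← lintegral_indicator hS, lintegral_piMeasure α hq hqp
    (Measurable.indicator (by fun_prop) hS), ← lintegral_indicator hT]
  refine lintegral_mono_ae ?_
  filter_upwards [ae_pos_stableMeasure (q / p)] with x hx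
  by_cases h : x ^ (-(1 / p)) ∈ S
  · rw [indicator_of_mem h, indicator_of_mem (hST x hx h), ← ENNReal.ofReal_mul (by positivity),
      ← Real.rpow_mul hx.le, ← Real.rpow_add hx]
    refine le_of_eq ?_
    congr 2
    ring
  · rw [indicator_of_notMem h, mul_zero]
    exact zero_le

theorem setLIntegral_rpow_piMeasure_Ici_ne_top (α e : ℝ) {p q δ : ℝ} (hq : 0 < q) (hqp : q < p)
    (hδ : 0 < δ) : ∫⁻ s in Ici δ, ENNReal.ofReal (s ^ e) ∂(piMeasure α p q) ≠ ∞ := by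
  have hp : 0 < p := hq.trans hqp
  refine ne_top_of_le_ne_top (setLIntegral_rpow_stableMeasure_Ioc_ne_top ((α - e) / p)
    (div_pos hq hp) ((div_lt_one hp).2 hqp) (Real.rpow_pos_of_pos hδ (-p)))
    (setLIntegral_piMeasure_le α hq hqp measurableSet_Ici measurableSet_Ioc (fun x hx h => ⟨hx, ?_⟩) e)
  have := Real.rpow_le_rpow_of_nonpos hδ (mem_Ici.1 h) (neg_nonpos.2 hp.le)
  rwa [← Real.rpow_mul hx.le, show -(1 / p) * -p = 1 by field_simp, Real.rpow_one] at this

theorem setLIntegral_rpow_piMeasure_Ioo_ne_top {α e p q : ℝ} (hq : 0 < q) (hqp : q < p)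
    (he : α - q < e) : ∫⁻ s in Ioo (0 : ℝ) 1, ENNReal.ofReal (s ^ e) ∂(piMeasure α p q) ≠ ∞ := by
  have hp : 0 < p := hq.trans hqp
  refine ne_top_of_le_ne_top (setLIntegral_rpow_stableMeasure_Ioi_ne_top (m := (α - e) / p)
    (div_pos hq hp) ((div_lt_one hp).2 hqp) (by gcongr; linarith))
    (setLIntegral_piMeasure_le α hq hqp measurableSet_Ioo measurableSet_Ioi (fun x hx h => ?_) e)
  by_contra hx1
  exact absurd h.2 (not_lt.2 (Real.one_le_rpow_of_pos_of_le_one_of_nonpos hx (not_lt.1 hx1)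
    (neg_nonpos.2 (by positivity))))

theorem rpow_neg_one_div_mem_Ico_iff {p A t x : ℝ} (hp : 0 < p) (hA : 1 ≤ A) (ht : 0 < t)
    (hx : 0 < x) : x ^ (-(1 / p)) ∈ Ico (t / A) t ↔ x ∈ Ioc (t ^ (-p)) (A ^ p * t ^ (-p)) := by
  have hA0 : 0 < A := by linarith
  have e1 : A ^ p * t ^ (-p) = (t / A) ^ (-p) := by
    rw [Real.div_rpow ht.le hA0.le, Real.rpow_neg hA0.le, div_inv_eq_mul, mul_comm]
  have e2 : x = (x ^ (-(1 / p))) ^ (-p) := by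
    rw [← Real.rpow_mul hx.le, show -(1 / p) * -p = 1 by field_simp, Real.rpow_one]
  have hy : 0 < x ^ (-(1 / p)) := Real.rpow_pos_of_pos hx _
  rw [e1]
  generalize x ^ (-(1 / p)) = y at e2 hy
  subst e2
  rw [mem_Ico, mem_Ioc, Real.rpow_lt_rpow_iff_of_neg ht hy (neg_lt_zero.2 hp),
    Real.rpow_le_rpow_iff_of_neg hy (by positivity) (neg_lt_zero.2 hp), and_comm]

theorem piMeasure_Ico (α : ℝ) {p q A t : ℝ} (hq : 0 < q) (hqp : q < p) (hA : 1 ≤ A) (ht : 0 < t) :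
    piMeasure α p q (Ico (t / A) t) = ∫⁻ x in Ioc (t ^ (-p)) (A ^ p * t ^ (-p)),
      ENNReal.ofReal (x ^ (α / p)) ∂(stableMeasure (q / p)) := by
  rw [← lintegral_indicator_one measurableSet_Ico, lintegral_piMeasure α hq hqp
    (measurable_one.indicator measurableSet_Ico), ← lintegral_indicator measurableSet_Ioc]
  refine lintegral_congr_ae ?_
  filter_upwards [ae_pos_stableMeasure (q / p)] with x hx
  simp only [indicator, rpow_neg_one_div_mem_Ico_iff (hq.trans hqp) hA ht hx]
  split_ifs <;> simp

/-- The window [t/A, t) corresponds to (t^{-p}, A^p t^{-p}], where the weight x^{α/p} is comparable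
to t^{-α}. The stable mass is at most of order (t^{-p})^{-q/p} = t^q, and at least of that order for
suitable A; together they give t^{-(α-q)}. -/
theorem hasPowerOrder_piMeasure (α : ℝ) {p q : ℝ} (hq : 0 < q) (hqp : q < p) :
    HasPowerOrder (α - q) (piMeasure α p q) := by
  have hp : 0 < p := hq.trans hqp
  have h0 : 0 < q / p := div_pos hq hp
  have h1 : q / p < 1 := (div_lt_one hp).2 hqp
  have hbound : ∀ A : ℝ, 1 ≤ A → ∀ t : ℝ, 0 < t → ∀ x ∈ Ioc (t ^ (-p)) (A ^ p * t ^ (-p)),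
      x ^ (α / p) ∈ Icc ((A ^ p) ^ (-|α / p|) * t ^ (-α)) ((A ^ p) ^ |α / p| * t ^ (-α)) := by
    intro A hA t ht x hx
    have hA1 : 1 ≤ A ^ p := Real.one_le_rpow hA hp.le
    have hX : 0 < t ^ (-p) := Real.rpow_pos_of_pos ht _
    have h := rpow_mem_Icc_mul (α / p) hA1 hX ⟨(div_le_self hX.le hA1).trans hx.1.le, hx.2⟩
    rwa [← Real.rpow_mul ht.le, show -p * (α / p) = -α by field_simp] at h
  have hexp : ∀ t : ℝ, 0 < t → (t ^ (-p)) ^ (-(q / p)) = t ^ q := fun t ht => by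
    rw [← Real.rpow_mul ht.le, show -p * -(q / p) = q by field_simp]
  have hsplit : ∀ t : ℝ, 0 < t → t ^ (-(α - q)) = t ^ (-α) * t ^ q := fun t ht => by
    rw [← Real.rpow_add ht]; ring_nf
  refine ⟨⟨ENNReal.ofReal (((2 : ℝ) ^ p) ^ |α / p| * 2), ENNReal.ofReal_ne_top, fun t ht => ?_⟩,
    ?_, ?_⟩
  · have ht0 : 0 < t := ht.1
    rw [piMeasure_Ico α hq hqp one_le_two ht0]
    calc _ ≤ ∫⁻ x in Ioc (t ^ (-p)) (2 ^ p * t ^ (-p)),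
          ENNReal.ofReal (((2 : ℝ) ^ p) ^ |α / p| * t ^ (-α)) ∂(stableMeasure (q / p)) :=
          setLIntegral_mono' measurableSet_Ioc fun x hx =>
            ENNReal.ofReal_le_ofReal (hbound 2 one_le_two t ht0 x hx).2
      _ ≤ ENNReal.ofReal (((2 : ℝ) ^ p) ^ |α / p| * t ^ (-α)) *
          ENNReal.ofReal (2 * (t ^ (-p)) ^ (-(q / p))) := by
          rw [setLIntegral_const]
          gcongr
          exact (measure_mono fun x hx => mem_Ici.2 hx.1.le).trans
            (stableMeasure_Ici_le h0 h1 (by positivity))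
      _ = _ := by
          rw [hexp t ht0, hsplit t ht0, ← ENNReal.ofReal_mul (by positivity),
            ← ENNReal.ofReal_mul (by positivity)]
          congr 1
          ring
  · obtain ⟨B, hB, c, hc, hlow⟩ := le_stableMeasure_Ioc h0 h1
    have hB0 : 0 < B := by linarith
    have hA : 1 ≤ B ^ (1 / p) := Real.one_le_rpow hB (by positivity)
    have hAB : (B ^ (1 / p)) ^ p = B := by
      rw [← Real.rpow_mul hB0.le, one_div_mul_cancel hp.ne', Real.rpow_one]
    -- A = B^{1/p} makes the transported window exactly the one of `le_stableMeasure_Ioc`; t < 1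
    -- supplies its condition t^{-p} ≥ 1.
    refine ⟨B ^ (1 / p), hA, ENNReal.ofReal (B ^ (-|α / p|) * c)⁻¹, ENNReal.ofReal_ne_top,
      fun t ht => ?_⟩
    have ht0 : 0 < t := ht.1
    have hb := hbound _ hA t ht0
    rw [piMeasure_Ico α hq hqp hA ht0]
    rw [hAB] at hb ⊢
    have ht1 : 1 ≤ t ^ (-p) :=
      Real.one_le_rpow_of_pos_of_le_one_of_nonpos ht0 ht.2.le (neg_nonpos.2 hp.le)
    calc ENNReal.ofReal (t ^ (-(α - q))) = ENNReal.ofReal (B ^ (-|α / p|) * c)⁻¹ *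
          (ENNReal.ofReal (B ^ (-|α / p|) * t ^ (-α)) *
            ENNReal.ofReal (c * (t ^ (-p)) ^ (-(q / p)))) := by
          rw [hexp t ht0, hsplit t ht0, ← ENNReal.ofReal_mul (by positivity),
            ← ENNReal.ofReal_mul (by positivity)]
          congr 1
          have : (0 : ℝ) < B ^ (-|α / p|) := by positivity
          field_simp
      _ ≤ ENNReal.ofReal (B ^ (-|α / p|) * c)⁻¹ *
          (ENNReal.ofReal (B ^ (-|α / p|) * t ^ (-α)) *
            stableMeasure (q / p) (Ioc (t ^ (-p)) (B * t ^ (-p)))) := by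
          gcongr
          exact hlow _ ht1
      _ ≤ _ := by
          rw [← setLIntegral_const]
          refine mul_le_mul_right (setLIntegral_mono' measurableSet_Ioc fun x hx =>
            ENNReal.ofReal_le_ofReal (hb x hx).1) _
  · have := setLIntegral_rpow_piMeasure_Ici_ne_top α 2 hq hqp (δ := 1 / 4) (by norm_num)
    simp only [Real.rpow_two] at this
    exact this

/-! ### s-finiteness and the five inclusions -/

instance (α p : ℝ) : SFinite (psi α p) := by unfold psi; infer_instance

instance (α β p : ℝ) : SFinite (tau β α p) := by unfold tau; infer_instance

instance (α p q : ℝ) : SFinite (piMeasure α p q) := by unfold piMeasure; infer_instance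

end UpsilonTransform

open UpsilonTransform in
theorem lemma2 (d : ℕ) {α β γ p q r : ℝ} (hγβ : γ < β) (hβα : β < α)
    (hr : 0 < r) (hrq : r < q) (hqp : q < p) :
    UpsilonTransform.upsilonRange d (UpsilonTransform.tau β α p) ⊆
        UpsilonTransform.upsilonDomain d (UpsilonTransform.psi β p) ∧
    UpsilonTransform.upsilonRange d (UpsilonTransform.tau β α p) ⊆
        UpsilonTransform.upsilonDomain d (UpsilonTransform.tau γ β p) ∧
    UpsilonTransform.upsilonRange d (UpsilonTransform.psi α p) ⊆
        UpsilonTransform.upsilonDomain d (UpsilonTransform.piMeasure α p q) ∧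
    UpsilonTransform.upsilonRange d (UpsilonTransform.piMeasure α q r) ⊆
        UpsilonTransform.upsilonDomain d (UpsilonTransform.piMeasure α p q) ∧
    UpsilonTransform.upsilonRange d (UpsilonTransform.tau β α p) ⊆
        UpsilonTransform.upsilonDomain d (UpsilonTransform.piMeasure α p q) := by
  have hq : 0 < q := hr.trans hrq
  have hp : 0 < p := hq.trans hqp
  have hψ := setLIntegral_rpow_psi_Ici_ne_top β 2 hp one_pos
  have hπ := setLIntegral_rpow_piMeasure_Ici_ne_top α 2 hq hqp one_pos
  simp only [Real.rpow_two] at hψ hπ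
  refine ⟨?_, ?_, ?_, ?_, ?_⟩
  · exact upsilonRange_subset_upsilonDomain d (hasPowerOrder_tau hβα hp)
      (setLIntegral_rpow_psi_Ioo_ne_top hp hβα) hψ
  · exact upsilonRange_subset_upsilonDomain d (hasPowerOrder_tau hβα hp)
      (setLIntegral_rpow_tau_Ioo_ne_top hγβ hp hβα)
      (by rw [setLIntegral_tau_Ici_one]; exact ENNReal.zero_ne_top)
  · exact upsilonRange_subset_upsilonDomain d (hasPowerOrder_psi α hp)
      (setLIntegral_rpow_piMeasure_Ioo_ne_top hq hqp (by linarith)) hπ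
  -- Here the range measure has order α - r, which exceeds α - q because r < q.
  · exact upsilonRange_subset_upsilonDomain d (hasPowerOrder_piMeasure α hr hrq)
      (setLIntegral_rpow_piMeasure_Ioo_ne_top hq hqp (by linarith)) hπ
  · exact upsilonRange_subset_upsilonDomain d (hasPowerOrder_tau hβα hp)
      (setLIntegral_rpow_piMeasure_Ioo_ne_top hq hqp (by linarith)) hπ
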